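/- **Setting.** For $p\ge 0$ and a weight vector $w_1\ge w_2\ge\dots\ge w_n>0$, the rank-1 inhomogeneous random graph $G(\mathbf W,p)$ is the random graph on $\{1,\dots,n\}$ in which each pair $\{i,j\}$, $i\ne j$, is an edge with probability $1-e^{-w_iw_jp}$, independently over pairs. The size of a connected component is its number of vertices, and its weight is the sum of the $w_i$ over its vertices. For every $n$ let a weight vector $\mathbf W=\mathbf W^{(n)}=(w_1,\dots,w_n)$ be given (the $w_i$ may depend on $n$), and put $\ell_n=\sum_{i=1}^n w_i$. Let $W$ be a positive random variable. The *conditions* are: 1. the weight of a uniformly chosen vertex converges in distribution to $W$ as $n\to\infty$; 2. $\mathbb E[W^3]<\infty$; 3. $\mathbb E[W^2]=\mathbb E[W]$; 4. $\ell_n=\mathbb E[W]\,n+o(n^{2/3})$; 5. $\sum_{k=1}^n w_k^2=\mathbb E[W^2]\,n+o(n^{2/3})$; 6. $\sum_{k=1}^n w_k^3=\mathbb E[W^3]\,n+o(n)$; 7. $\max_{i\le n}w_i=o(n^{1/3})$. Write $C=\mathbb E[W^3]/\mathbb E[W]$ and, for a real number $f$, $p_f=(\ell_n^{1/3}+f)/\ell_n^{4/3}$.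 **Theorem (size and weight of the giant component).** There is a constant $A>0$, depending only on the distribution of $W$, such that for every $\varepsilon'\in(0,1]$ there is a constant $F>0$, depending only on $\varepsilon'$ and the distribution of $W$, with the following property. Suppose that the weight vectors satisfy the conditions, that $f_n=o(n^{1/3})$, and that $f_n\ge F$ for all large $n$. Then for all sufficiently large $n$, with probability at least $$1-A\exp\left(-\frac{f_n}{A}\right),$$ the largest connected component of $G(\mathbf W,p_{f_n})$ (each one of maximal size, in case of ties) has its size in $$\left[\frac{2(1-\varepsilon'/2)f_n\ell_n^{2/3}}{C}-\frac{\ell_n^{2/3}}{C},\ \frac{2(1+\varepsilon'/2)f_n\ell_n^{2/3}}{C}\right]$$ and its weight in $$\left[\frac{2(1-\varepsilon')f_n\ell_n^{2/3}}{C},\ \frac{2(1+\varepsilon')f_n\ell_n^{2/3}}{C}\right].$$ -/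

import Mathlib

open MeasureTheory Filter Asymptotics Topology
open scoped BoundedContinuousFunction

noncomputable section

namespace RankOne

/-! ### The rank-1 inhomogeneous random graph -/

/-- The potential edges of a graph on `n` labelled vertices: the pair `(i, j)` with `i < j` stands
for the unordered pair `{i, j}`. -/
abbrev Slot (n : ℕ) : Type := {e : Fin n × Fin n // e.1 < e.2}

/-- The probability `1 - exp (-(w_i w_j p))` that `{i, j}` is an edge, as a point of `[0, 1]`.
The projection onto `[0, 1]` changes nothing for positive weights and `p ≥ 0`. -/
def edgeProb {n : ℕ} (w : Fin n → ℝ) (p : ℝ) (e : Slot n) : unitInterval :=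
  Set.projIcc (0 : ℝ) 1 zero_le_one (1 - Real.exp (-(w e.1.1 * w e.1.2 * p)))

/-- The joint law of the edge indicators: independent Bernoulli variables, the one of `{i, j}`
with parameter `1 - exp (-(w_i w_j p))`. -/
def edgeLaw {n : ℕ} (w : Fin n → ℝ) (p : ℝ) : Measure (Slot n → Bool) :=
  Measure.pi fun e => ProbabilityTheory.bernoulliMeasure true false (edgeProb w p e)

/-- The graph on `n` vertices whose edges are the slots marked `true`. Under `edgeLaw w p` this is
the rank-1 inhomogeneous random graph `G(w, p)`. -/
def graphOf {n : ℕ} (ω : Slot n → Bool) : SimpleGraph (Fin n) :=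
  SimpleGraph.fromEdgeSet {s | ∃ e : Slot n, ω e = true ∧ s = s(e.1.1, e.1.2)}

/-! ### Components, their sizes and weights -/

/-- The number of vertices of a connected component. -/
def compSize {n : ℕ} {G : SimpleGraph (Fin n)} (c : G.ConnectedComponent) : ℕ := c.supp.ncard

open Classical in
/-- The sum of the weights of the vertices of a connected component. -/
def compWeight {n : ℕ} (w : Fin n → ℝ) {G : SimpleGraph (Fin n)} (c : G.ConnectedComponent) : ℝ :=
  ∑ i with i ∈ c.supp, w i

/-- `c` has the maximal number of vertices among all connected components. -/
def IsLargest {n : ℕ} {G : SimpleGraph (Fin n)} (c : G.ConnectedComponent) : Prop :=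
  ∀ c' : G.ConnectedComponent, compSize c' ≤ compSize c

/-! ### Weights -/

/-- The total weight `ℓ_n`. -/
def totalWeight {n : ℕ} (w : Fin n → ℝ) : ℝ := ∑ i, w i

/-- The `k`-th moment `E[W ^ k]` of a law `ν` on the real line. -/
def moment (ν : Measure ℝ) (k : ℕ) : ℝ := ∫ x, x ^ k ∂ν

/-- The constant `C = E[W ^ 3] / E[W]`. -/
def constC (ν : Measure ℝ) : ℝ := moment ν 3 / moment ν 1

/-- The standing conditions on the weight vectors `w n = (w_1 ≥ ... ≥ w_n > 0)`, where `ν` is the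
law of the limiting positive random variable `W`. -/
structure WeightConditions (ν : Measure ℝ) (w : (n : ℕ) → Fin n → ℝ) : Prop where
  pos : ∀ n i, 0 < w n i
  antitone : ∀ n, Antitone (w n)
  /-- `W` is positive. -/
  law_pos : ∀ᵐ x ∂ν, 0 < x
  /-- The weight of a uniformly chosen vertex converges in distribution to `W`. -/
  weak_limit : ∀ g : ℝ →ᵇ ℝ,
    Tendsto (fun n : ℕ => (∑ i, g (w n i)) / (n : ℝ)) atTop (𝓝 (∫ x, g x ∂ν))
  /-- `E[W ^ 3] < ∞`. -/
  third_moment : Integrable (fun x : ℝ => x ^ 3) ν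
  /-- `E[W ^ 2] = E[W]`. -/
  second_eq_first : moment ν 2 = moment ν 1
  sum_one : (fun n : ℕ => totalWeight (w n) - moment ν 1 * n)
    =o[atTop] fun n : ℕ => (n : ℝ) ^ (2 / 3 : ℝ)
  sum_two : (fun n : ℕ => (∑ i, w n i ^ 2) - moment ν 2 * n)
    =o[atTop] fun n : ℕ => (n : ℝ) ^ (2 / 3 : ℝ)
  sum_three : (fun n : ℕ => (∑ i, w n i ^ 3) - moment ν 3 * n) =o[atTop] fun n : ℕ => (n : ℝ)
  max_weight : (fun n : ℕ => ⨆ i, w n i) =o[atTop] fun n : ℕ => (n : ℝ) ^ (1 / 3 : ℝ)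

/-- The edge parameter `p_f = (ℓ ^ (1/3) + f) / ℓ ^ (4/3)`, with `ℓ` the total weight. -/
def critParam (ℓ f : ℝ) : ℝ := (ℓ ^ (1 / 3 : ℝ) + f) / ℓ ^ (4 / 3 : ℝ)

/-! ### The event -/

/-- The largest connected component of `G` (each one, should several have the maximal size) has
`2(1 - ε/2) f ℓ^(2/3) / C - ℓ^(2/3) / C ≤ size ≤ 2(1 + ε/2) f ℓ^(2/3) / C` and
`2(1 - ε) f ℓ^(2/3) / C ≤ weight ≤ 2(1 + ε) f ℓ^(2/3) / C`, with `ℓ` the total weight. -/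
def GiantEvent {n : ℕ} (C ε f : ℝ) (w : Fin n → ℝ) (G : SimpleGraph (Fin n)) : Prop :=
  ∀ c : G.ConnectedComponent, IsLargest c →
    (compSize c : ℝ) ∈ Set.Icc
      (2 * (1 - ε / 2) * f * totalWeight w ^ (2 / 3 : ℝ) / C - totalWeight w ^ (2 / 3 : ℝ) / C)
      (2 * (1 + ε / 2) * f * totalWeight w ^ (2 / 3 : ℝ) / C) ∧
    compWeight w c ∈ Set.Icc
      (2 * (1 - ε) * f * totalWeight w ^ (2 / 3 : ℝ) / C)
      (2 * (1 + ε) * f * totalWeight w ^ (2 / 3 : ℝ) / C)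

end RankOne

end

noncomputable section

namespace RankOne

/-! ### Events determined by a set of potential edges -/

/-! The graph is explored vertex by vertex, and explored weight serves as the clock. Write `u = f /
ℓ^(1/3)`, so that `p ∑ w² ≈ 1 + u`, and let `x = 2uℓ/C` be the target weight. Revealing an active
vertex `a` discovers each fresh vertex `v` with probability about `w_a w_v p`, so per unit of clock
time the discovered sums of `1`, `w`, `w²` grow at rates `p ∑_U w ≈ 1`, `p ∑_U w²` and `p ∑_U w³ ≈
C`, with `U` the undiscovered set. Hence the discovered vertices have total squared weight about
`Ct` at time `t`, the rate of discovery of weight is `1 + u - Ct/ℓ`, and the active weight minus the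
root weight follows the parabola `ut - Ct²/(2ℓ) = u t (1 - t/x)`. Its positive excursion ends near
`x`: this is the giant component. The count of discovered vertices follows the clock, so its size is
near `x` as well.

Concentration comes from six exponential supermartingales, one for each side of each of the three
sums (`integral_exp_nbrs_le_one`, `integral_exp_neg_nbrs_le_one`, `integral_exp_expo_le`). Each
starts at `exp (-f)` and reaches 1 when its deviation becomes too large. Their drift is bounded only
at states where all six deviations are still small, which suffices because the exploration stops
when this fails; control of the squared weights bounds the drift of the weights. `edgeLaw_run_le` is
the optional stopping argument, resting on the independence of unrevealed edges from the past.

Under control the exploration runs out of active vertices only very early or near time `x`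
(`Good.le_time`, `Good.time_le`). The early components together are negligible, and after time about
`x` the undiscovered graph is subcritical, with clusters of size at least `x/2` only with
probability at most `exp (-f)` (`Good.edgeLaw_bigCluster_le`). So the component explored last is the
unique largest one (`largest_of_not_fail`), with total failure probability at most `7 exp (-f)`
(`edgeLaw_fail_le`). `eventually_valid` derives the quantitative hypotheses from the asymptotic
ones. -/

instance edgeLaw_isProbabilityMeasure {n : ℕ} (w : Fin n → ℝ) (p : ℝ) :
    IsProbabilityMeasure (edgeLaw w p) := by
  unfold edgeLaw; infer_instance

/-- The event `E` is determined by the states of the potential edges in `S`. -/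
def DeterminedBy {n : ℕ} (S : Set (Slot n)) (E : Set (Slot n → Bool)) : Prop :=
  ∀ ω ω' : Slot n → Bool, (∀ e ∈ S, ω e = ω' e) → ω ∈ E → ω' ∈ E

/-- The potential edges with both ends in `W`. -/
def slotsIn {n : ℕ} (W : Finset (Fin n)) : Set (Slot n) := {e | e.1.1 ∈ W ∧ e.1.2 ∈ W}

/-- The potential edges with an end at `a`. -/
def slotsAt {n : ℕ} (a : Fin n) : Set (Slot n) := {e | e.1.1 = a ∨ e.1.2 = a}

lemma DeterminedBy.mono {n : ℕ} {S T : Set (Slot n)} {E : Set (Slot n → Bool)} (h : S ⊆ T)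
    (hE : DeterminedBy S E) : DeterminedBy T E :=
  fun ω ω' hω => hE ω ω' fun e he => hω e (h he)

lemma slotsIn_mono {n : ℕ} {W W' : Finset (Fin n)} (h : W ⊆ W') : slotsIn W ⊆ slotsIn W' :=
  fun _ he => ⟨h he.1, h he.2⟩

lemma disjoint_slotsAt_slotsIn {n : ℕ} {a : Fin n} {W : Finset (Fin n)} (ha : a ∉ W) :
    Disjoint (slotsAt a) (slotsIn W) := by
  rw [Set.disjoint_left]
  rintro e (rfl | rfl) ⟨h1, h2⟩
  · exact ha h1
  · exact ha h2

open Classical in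
-- An event determined by a set of slots is the preimage of its own image under restriction to these
-- slots, so independence of disjoint blocks of coordinates applies.
lemma edgeLaw_inter {n : ℕ} (w : Fin n → ℝ) (p : ℝ) {S T : Set (Slot n)} (hST : Disjoint S T)
    {E F : Set (Slot n → Bool)} (hE : DeterminedBy S E) (hF : DeterminedBy T F) :
    (edgeLaw w p).real (E ∩ F) = (edgeLaw w p).real E * (edgeLaw w p).real F := by
  have hind : ProbabilityTheory.iIndepFun (fun (e : Slot n) (ω : Slot n → Bool) => ω e)
      (edgeLaw w p) :=
    ProbabilityTheory.iIndepFun_pi (X := fun _ b => b) fun _ => aemeasurable_id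
  have key := hind.indepFun_finset S.toFinset T.toFinset
    (by rw [Set.disjoint_toFinset]; exact hST) fun e => measurable_pi_apply e
  have hpre : ∀ {R : Set (Slot n)} {D : Set (Slot n → Bool)}, DeterminedBy R D →
      D = (fun ω (i : R.toFinset) => ω i) ⁻¹' ((fun ω (i : R.toFinset) => ω i) '' D) := by
    intro R D hD
    ext ω
    refine ⟨fun h => ⟨ω, h, rfl⟩, ?_⟩
    rintro ⟨ω', h, he⟩
    exact hD ω' ω (fun e heR => congrFun he ⟨e, Set.mem_toFinset.2 heR⟩) h
  have := key.measure_inter_preimage_eq_mul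
    ((fun ω (i : S.toFinset) => ω i) '' E) ((fun ω (i : T.toFinset) => ω i) '' F)
    (Set.toFinite _).measurableSet (Set.toFinite _).measurableSet
  rw [← hpre hE, ← hpre hF] at this
  simp [measureReal_def, this, ENNReal.toReal_mul]

/-! ### Adjacency -/

/-- The potential edge between two distinct vertices. -/
def slotOf {n : ℕ} (a b : Fin n) (h : a ≠ b) : Slot n :=
  if hlt : a < b then ⟨(a, b), hlt⟩ else ⟨(b, a), lt_of_le_of_ne (not_lt.1 hlt) h.symm⟩

lemma slotOf_cases {n : ℕ} {a b : Fin n} (h : a ≠ b) :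
    ((slotOf a b h).1.1 = a ∧ (slotOf a b h).1.2 = b) ∨
      ((slotOf a b h).1.1 = b ∧ (slotOf a b h).1.2 = a) := by
  unfold slotOf; split_ifs <;> simp

lemma adj_iff {n : ℕ} {ω : Slot n → Bool} {a b : Fin n} (h : a ≠ b) :
    (graphOf ω).Adj a b ↔ ω (slotOf a b h) = true := by
  simp only [graphOf, SimpleGraph.fromEdgeSet_adj, Set.mem_ofPred_eq, ne_eq, h, not_false_eq_true,
    and_true]
  constructor
  · rintro ⟨e, he, hs⟩
    have : slotOf a b h = e := by
      have hlt := e.2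
      rcases Sym2.eq_iff.1 hs with ⟨rfl, rfl⟩ | ⟨rfl, rfl⟩
      · simp [slotOf, hlt]
      · simp [slotOf, hlt.not_gt]
    rwa [this]
  · intro he
    refine ⟨_, he, ?_⟩
    rcases slotOf_cases h with ⟨h1, h2⟩ | ⟨h1, h2⟩
    · rw [h1, h2]
    · rw [h1, h2, Sym2.eq_swap]

lemma adj_congr {n : ℕ} {ω ω' : Slot n → Bool} {a b : Fin n}
    (h : ∀ hab : a ≠ b, ω (slotOf a b hab) = ω' (slotOf a b hab)) :
    (graphOf ω).Adj a b ↔ (graphOf ω').Adj a b := by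
  by_cases hab : a = b
  · subst hab; simp
  · rw [adj_iff hab, adj_iff hab, h hab]

lemma slotOf_mem_slotsIn {n : ℕ} {a b : Fin n} (h : a ≠ b) {W : Finset (Fin n)} (ha : a ∈ W)
    (hb : b ∈ W) : slotOf a b h ∈ slotsIn W := by
  rcases slotOf_cases h with ⟨h1, h2⟩ | ⟨h1, h2⟩ <;> simp [slotsIn, h1, h2, ha, hb]

lemma slotOf_mem_slotsAt {n : ℕ} {a b : Fin n} (h : a ≠ b) : slotOf a b h ∈ slotsAt a := by
  rcases slotOf_cases h with ⟨h1, h2⟩ | ⟨h1, h2⟩ <;> simp [slotsAt, h1, h2]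

open Classical in
/-- The neighbours of `a` in `U`. -/
def nbrs {n : ℕ} (ω : Slot n → Bool) (a : Fin n) (U : Finset (Fin n)) : Finset (Fin n) :=
  U.filter fun u => (graphOf ω).Adj a u

lemma mem_nbrs {n : ℕ} {ω : Slot n → Bool} {a u : Fin n} {U : Finset (Fin n)} :
    u ∈ nbrs ω a U ↔ u ∈ U ∧ (graphOf ω).Adj a u := by simp [nbrs]

lemma nbrs_subset {n : ℕ} (ω : Slot n → Bool) (a : Fin n) (U : Finset (Fin n)) :
    nbrs ω a U ⊆ U := fun _ hu => (mem_nbrs.1 hu).1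

lemma nbrs_congr {n : ℕ} {ω ω' : Slot n → Bool} {a : Fin n} {U : Finset (Fin n)}
    (h : ∀ u ∈ U, ∀ hau : a ≠ u, ω (slotOf a u hau) = ω' (slotOf a u hau)) :
    nbrs ω a U = nbrs ω' a U := by
  ext u
  simp only [mem_nbrs, and_congr_right_iff]
  exact fun hu => adj_congr (h u hu)

lemma integrable_edgeLaw {n : ℕ} (w : Fin n → ℝ) (p : ℝ) (φ : (Slot n → Bool) → ℝ) :
    Integrable φ (edgeLaw w p) := Integrable.of_finite

open Classical in
/-- Averaging over the neighbours of a revealed vertex. -/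
lemma edgeLaw_nbrs_le {n : ℕ} (w : Fin n → ℝ) (p : ℝ) {a : Fin n} {U W : Finset (Fin n)}
    (ha : a ∉ W) (E : Finset (Fin n) → Set (Slot n → Bool))
    (hE : ∀ N ⊆ U, DeterminedBy (slotsIn W) (E N)) (ψ : Finset (Fin n) → ℝ)
    (hψ : ∀ N ⊆ U, (edgeLaw w p).real (E N) ≤ ψ N) :
    (edgeLaw w p).real {ω | ω ∈ E (nbrs ω a U)} ≤ ∫ ω, ψ (nbrs ω a U) ∂(edgeLaw w p) := by
  set μ := edgeLaw w p
  have hX : ∀ N, MeasurableSet {ω : Slot n → Bool | nbrs ω a U = N} :=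
    fun N => (Set.toFinite _).measurableSet
  have hX' : ∀ N, DeterminedBy (slotsAt a) {ω : Slot n → Bool | nbrs ω a U = N} := by
    intro N ω ω' h hω
    rw [Set.mem_ofPred_eq] at hω ⊢
    rw [← hω]
    exact (nbrs_congr fun u _ hau => h _ (slotOf_mem_slotsAt hau)).symm
  have h1 : {ω | ω ∈ E (nbrs ω a U)} =
      ⋃ N ∈ U.powerset, {ω | nbrs ω a U = N} ∩ E N := by
    ext ω
    simp only [Set.mem_ofPred_eq, Finset.mem_powerset, Set.mem_iUnion, Set.mem_inter_iff]
    exact ⟨fun h => ⟨_, nbrs_subset ω a U, rfl, h⟩, by rintro ⟨N, -, rfl, h⟩; exact h⟩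
  have h2 : ∫ ω, ψ (nbrs ω a U) ∂μ
      = ∑ N ∈ U.powerset, μ.real {ω | nbrs ω a U = N} * ψ N := by
    have : (fun ω => ψ (nbrs ω a U)) = fun ω => ∑ N ∈ U.powerset,
        Set.indicator {ω | nbrs ω a U = N} (fun _ => ψ N) ω := by
      ext ω
      rw [Finset.sum_eq_single (nbrs ω a U)]
      · simp
      · intro N _ hN
        simp [Set.indicator, hN.symm]
      · intro h
        exact absurd (Finset.mem_powerset.2 (nbrs_subset ω a U)) h
    rw [this, integral_finsetSum _ fun _ _ => integrable_edgeLaw w p _]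
    refine Finset.sum_congr rfl fun N _ => ?_
    rw [integral_indicator_const _ (hX N), smul_eq_mul]
  rw [h1, h2]
  refine (measureReal_biUnion_finset_le _ _).trans (Finset.sum_le_sum fun N hN => ?_)
  have hN := Finset.mem_powerset.1 hN
  rw [edgeLaw_inter w p (disjoint_slotsAt_slotsIn ha) (hX' N) (hE N hN)]
  exact mul_le_mul_of_nonneg_left (hψ N hN) measureReal_nonneg

/-! ### Exponential moments of the revealed neighbourhood -/

lemma edgeProb_slotOf {n : ℕ} {w : Fin n → ℝ} {p : ℝ} (hw : ∀ i, 0 ≤ w i) (hp : 0 ≤ p)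
    {a b : Fin n} (h : a ≠ b) :
    (edgeProb w p (slotOf a b h) : ℝ) = 1 - Real.exp (-(w a * w b * p)) := by
  have h0 : 0 ≤ w a * w b * p := mul_nonneg (mul_nonneg (hw a) (hw b)) hp
  have : (edgeProb w p (slotOf a b h) : ℝ)
      = Set.projIcc (0 : ℝ) 1 zero_le_one (1 - Real.exp (-(w a * w b * p))) := by
    unfold edgeProb
    rcases slotOf_cases h with ⟨h1, h2⟩ | ⟨h1, h2⟩ <;> rw [h1, h2]
    rw [mul_comm (w b)]
  rw [this, Set.projIcc_of_mem]
  exact ⟨by simpa using h0, by linarith [Real.exp_pos (-(w a * w b * p))]⟩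

open Classical in
-- The integrand is a product over slots of functions of single coordinates, hence its expectation
-- factors; `{a, u}` contributes `c u` when present and 1 otherwise.
lemma integral_prod_nbrs {n : ℕ} {w : Fin n → ℝ} {p : ℝ} (hw : ∀ i, 0 ≤ w i) (hp : 0 ≤ p)
    {a : Fin n} {U : Finset (Fin n)} (ha : a ∉ U) (c : Fin n → ℝ) :
    ∫ ω, ∏ u ∈ nbrs ω a U, c u ∂(edgeLaw w p)
      = ∏ u ∈ U, (1 + (1 - Real.exp (-(w a * w u * p))) * (c u - 1)) := by
  have hne : ∀ u : U, a ≠ u.1 := fun u h => ha (h ▸ u.2)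
  let σ : U → Slot n := fun u => slotOf a u.1 (hne u)
  have hσ : Function.Injective σ := by
    intro u v huv
    have huv' : slotOf a u.1 (hne u) = slotOf a v.1 (hne v) := huv
    have := hne u; have := hne v
    rcases slotOf_cases (hne u) with ⟨h1, h2⟩ | ⟨h1, h2⟩ <;>
    rcases slotOf_cases (hne v) with ⟨h3, h4⟩ | ⟨h3, h4⟩ <;> rw [huv'] at h1 h2 <;>
    apply Subtype.ext <;> grind
  -- A product over the fibre of `σ` makes the factor 1 for slots that do not join `a` to `U`; by
  -- injectivity no fibre has two elements.
  let F : Slot n → Bool → ℝ := fun e b =>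
    ∏ u ∈ Finset.univ.filter (fun u => σ u = e), if b then c u.1 else 1
  have h1 : ∀ ω : Slot n → Bool, ∏ u ∈ nbrs ω a U, c u = ∏ e, F e (ω e) := by
    intro ω
    have : ∏ e, F e (ω e) = ∏ u : U, if ω (σ u) then c u.1 else 1 := by
      rw [← Finset.prod_fiberwise (s := Finset.univ) (g := σ)]
      refine Finset.prod_congr rfl fun e _ => Finset.prod_congr rfl fun u hu => ?_
      rw [(Finset.mem_filter.1 hu).2]
    rw [this, nbrs, Finset.prod_filter, ← Finset.prod_coe_sort U]
    refine Finset.prod_congr rfl fun u _ => ?_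
    simp only [adj_iff (hne u), σ]
  simp_rw [h1]
  have h2 := integral_fintype_prod_eq_prod (𝕜 := ℝ)
    (μ := fun e => ProbabilityTheory.bernoulliMeasure true false (edgeProb w p e)) F
  have h3 : (edgeLaw w p) = Measure.pi
    fun e => ProbabilityTheory.bernoulliMeasure true false (edgeProb w p e) := rfl
  rw [h3, h2, ← Finset.prod_coe_sort U,
    ← Finset.prod_fiberwise (s := (Finset.univ : Finset U)) (g := σ)]
  refine Finset.prod_congr rfl fun e _ => ?_
  rw [ProbabilityTheory.integral_bernoulliMeasure]
  simp only [smul_eq_mul]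
  by_cases he : ∃ u, σ u = e
  · obtain ⟨u, rfl⟩ := he
    have : Finset.univ.filter (fun v => σ v = σ u) = {u} := by
      ext v; simp [hσ.eq_iff]
    simp only [F, this, Finset.prod_singleton, if_true, σ]
    rw [edgeProb_slotOf hw hp]
    simp; ring
  · have : Finset.univ.filter (fun v => σ v = e) = ∅ := by
      ext v; simpa using fun h => he ⟨v, h⟩
    simp only [F, this, Finset.prod_empty]; ring

/-- Since `(1 - y + y²/2)(1 + y + y²/2) = 1 + y⁴/4 ≥ 1` and the second factor is at most `exp y`,
the first is at least `exp (-y)`. -/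
lemma one_sub_exp_neg_ge {y : ℝ} (hy : 0 ≤ y) : y - y ^ 2 / 2 ≤ 1 - Real.exp (-y) := by
  have h := Real.quadratic_le_exp_of_nonneg hy
  have h1 : Real.exp (-y) * Real.exp y = 1 := by rw [← Real.exp_add]; simp
  have h2 : 0 < Real.exp (-y) := Real.exp_pos _
  by_contra hcon
  push Not at hcon
  have h3 : 1 - y + y ^ 2 / 2 < Real.exp (-y) := by linarith
  have h4 : 0 < 1 - y + y ^ 2 / 2 := by nlinarith [sq_nonneg (y - 1)]
  have h5 : (1 - y + y ^ 2 / 2) * (1 + y + y ^ 2 / 2) < 1 := by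
    calc _ ≤ (1 - y + y ^ 2 / 2) * Real.exp y := mul_le_mul_of_nonneg_left h h4.le
      _ < Real.exp (-y) * Real.exp y := mul_lt_mul_of_pos_right h3 (Real.exp_pos _)
      _ = 1 := h1
  nlinarith [sq_nonneg (y ^ 2)]

/-- The left side is `yb(1 - y - b)`, which is nonpositive once `y ≥ 1` or `b ≥ 1`; otherwise the
two quadratic bounds are multiplied. In the lower exponential moment the two error terms come from
the edge probability and from the variance. -/
lemma mul_one_sub_exp_neg_ge {y b : ℝ} (hy : 0 ≤ y) (hb : 0 ≤ b) :
    y * b - y ^ 2 * b - y * b ^ 2 ≤ (1 - Real.exp (-y)) * (1 - Real.exp (-b)) := by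
  have h1 := one_sub_exp_neg_ge hy
  have h2 := one_sub_exp_neg_ge hb
  have h3 : 0 ≤ 1 - Real.exp (-y) := by simpa using hy
  have h4 : 0 ≤ 1 - Real.exp (-b) := by simpa using hb
  have hyb := mul_nonneg hy hb
  by_cases hy1 : 1 ≤ y
  · have : 0 ≤ (1 - Real.exp (-y)) * (1 - Real.exp (-b)) := mul_nonneg h3 h4
    nlinarith [mul_nonneg hyb (sub_nonneg.2 hy1), mul_nonneg hyb hb]
  by_cases hb1 : 1 ≤ b
  · have : 0 ≤ (1 - Real.exp (-y)) * (1 - Real.exp (-b)) := mul_nonneg h3 h4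
    nlinarith [mul_nonneg hyb (sub_nonneg.2 hb1), mul_nonneg hyb hy]
  push Not at hy1 hb1
  have h5 : (y - y ^ 2 / 2) * (b - b ^ 2 / 2) ≤ (1 - Real.exp (-y)) * (1 - Real.exp (-b)) :=
    mul_le_mul h1 h2 (by nlinarith) h3
  nlinarith [mul_nonneg hyb hyb, mul_nonneg hyb hy, mul_nonneg hyb hb]

section Moments
variable {n : ℕ} {w : Fin n → ℝ} {p : ℝ}

/-- Upper exponential moment bound for the neighbours of a revealed vertex. -/
lemma integral_exp_nbrs_le_one (hw : ∀ i, 0 ≤ w i) (hp : 0 ≤ p) {a : Fin n}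
    {U : Finset (Fin n)} (ha : a ∉ U) {g : Fin n → ℝ} (hg : ∀ u, 0 ≤ g u) {θ c : ℝ} (hθ : 0 ≤ θ)
    (hθg : ∀ u, θ * g u ≤ 1)
    (hc : p * (∑ u ∈ U, w u * g u + θ * ∑ u ∈ U, w u * g u ^ 2) ≤ c) :
    ∫ ω, Real.exp (θ * (∑ u ∈ nbrs ω a U, g u - c * w a)) ∂(edgeLaw w p) ≤ 1 := by
  have h1 : ∀ ω : Slot n → Bool, Real.exp (θ * (∑ u ∈ nbrs ω a U, g u - c * w a))
      = Real.exp (-(θ * c * w a)) * ∏ u ∈ nbrs ω a U, Real.exp (θ * g u) := by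
    intro ω
    rw [← Real.exp_sum, ← Real.exp_add, ← Finset.mul_sum]
    ring_nf
  simp_rw [h1]
  rw [integral_const_mul, integral_prod_nbrs hw hp ha]
  -- Factor by factor: `1 - exp (-y) ≤ y`, then `exp b - 1 ≤ b + b²` for `0 ≤ b ≤ 1`, then `1 + z ≤
  -- exp z`. The `b²` is the variance term multiplied by `θ` in the hypothesis on `c`.
  have h2 : ∏ u ∈ U, (1 + (1 - Real.exp (-(w a * w u * p))) * (Real.exp (θ * g u) - 1))
      ≤ Real.exp (∑ u ∈ U, w a * w u * p * (θ * g u + (θ * g u) ^ 2)) := by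
    rw [Real.exp_sum]
    refine Finset.prod_le_prod (fun u _ => ?_) fun u _ => ?_
    · have h3 : 0 ≤ w a * w u * p := mul_nonneg (mul_nonneg (hw a) (hw u)) hp
      have h4 : 0 ≤ 1 - Real.exp (-(w a * w u * p)) := by simpa using h3
      have h5 : 0 ≤ Real.exp (θ * g u) - 1 := by
        simpa using mul_nonneg hθ (hg u)
      positivity
    · have h3 : 0 ≤ w a * w u * p := mul_nonneg (mul_nonneg (hw a) (hw u)) hp
      have h4 : 1 - Real.exp (-(w a * w u * p)) ≤ w a * w u * p := by
        linarith [Real.add_one_le_exp (-(w a * w u * p))]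
      have hb : 0 ≤ θ * g u := mul_nonneg hθ (hg u)
      have h5 : 0 ≤ Real.exp (θ * g u) - 1 := by simpa using hb
      have h6 : Real.exp (θ * g u) - 1 ≤ θ * g u + (θ * g u) ^ 2 := by
        have := Real.abs_exp_sub_one_sub_id_le (x := θ * g u)
          (by rw [abs_of_nonneg hb]; exact hθg u)
        linarith [(abs_le.1 this).2]
      have h7 : (1 - Real.exp (-(w a * w u * p))) * (Real.exp (θ * g u) - 1)
          ≤ w a * w u * p * (θ * g u + (θ * g u) ^ 2) := mul_le_mul h4 h6 h5 h3
      linarith [Real.add_one_le_exp (w a * w u * p * (θ * g u + (θ * g u) ^ 2))]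
  refine (mul_le_mul_of_nonneg_left h2 (Real.exp_pos _).le).trans ?_
  rw [← Real.exp_add, Real.exp_le_one_iff]
  have h3 : ∑ u ∈ U, w a * w u * p * (θ * g u + (θ * g u) ^ 2)
      = θ * w a * (p * (∑ u ∈ U, w u * g u + θ * ∑ u ∈ U, w u * g u ^ 2)) := by
    rw [Finset.mul_sum, ← Finset.sum_add_distrib, Finset.mul_sum, Finset.mul_sum]
    exact Finset.sum_congr rfl fun u _ => by ring
  rw [h3]
  linarith [mul_le_mul_of_nonneg_left hc (mul_nonneg hθ (hw a))]

/-- Lower exponential moment bound for the neighbours of a revealed vertex. -/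
lemma integral_exp_neg_nbrs_le_one (hw : ∀ i, 0 ≤ w i) (hp : 0 ≤ p) {a : Fin n}
    {U : Finset (Fin n)} (ha : a ∉ U) {g : Fin n → ℝ} (hg : ∀ u, 0 ≤ g u) {θ c : ℝ} (hθ : 0 ≤ θ)
    (hc : c ≤ p * (∑ u ∈ U, w u * g u - p * w a * ∑ u ∈ U, w u ^ 2 * g u
      - θ * ∑ u ∈ U, w u * g u ^ 2)) :
    ∫ ω, Real.exp (-(θ * (∑ u ∈ nbrs ω a U, g u - c * w a))) ∂(edgeLaw w p) ≤ 1 := by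
  have h1 : ∀ ω : Slot n → Bool, Real.exp (-(θ * (∑ u ∈ nbrs ω a U, g u - c * w a)))
      = Real.exp (θ * c * w a) * ∏ u ∈ nbrs ω a U, Real.exp (-(θ * g u)) := by
    intro ω
    rw [← Real.exp_sum, ← Real.exp_add, Finset.sum_neg_distrib, ← Finset.mul_sum]
    ring_nf
  simp_rw [h1]
  rw [integral_const_mul, integral_prod_nbrs hw hp ha]
  have h2 : ∏ u ∈ U, (1 + (1 - Real.exp (-(w a * w u * p))) * (Real.exp (-(θ * g u)) - 1))
      ≤ Real.exp (-∑ u ∈ U, (w a * w u * p * (θ * g u) - (w a * w u * p) ^ 2 * (θ * g u)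
        - (w a * w u * p) * (θ * g u) ^ 2)) := by
    rw [← Finset.sum_neg_distrib, Real.exp_sum]
    refine Finset.prod_le_prod (fun u _ => ?_) fun u _ => ?_
    · have h3 : 0 ≤ w a * w u * p := mul_nonneg (mul_nonneg (hw a) (hw u)) hp
      have h4 : 0 ≤ 1 - Real.exp (-(w a * w u * p)) := by simpa using h3
      have h5 := Real.exp_pos (-(θ * g u))
      have h6 := Real.exp_pos (-(w a * w u * p))
      nlinarith
    · have h3 : 0 ≤ w a * w u * p := mul_nonneg (mul_nonneg (hw a) (hw u)) hp
      have h4 := mul_one_sub_exp_neg_ge h3 (mul_nonneg hθ (hg u))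
      refine le_trans ?_ (Real.add_one_le_exp _)
      linarith
  refine (mul_le_mul_of_nonneg_left h2 (Real.exp_pos _).le).trans ?_
  rw [← Real.exp_add, Real.exp_le_one_iff]
  have h3 : ∑ u ∈ U, (w a * w u * p * (θ * g u) - (w a * w u * p) ^ 2 * (θ * g u)
        - (w a * w u * p) * (θ * g u) ^ 2)
      = θ * w a * (p * (∑ u ∈ U, w u * g u - p * w a * ∑ u ∈ U, w u ^ 2 * g u
      - θ * ∑ u ∈ U, w u * g u ^ 2)) := by
    simp only [Finset.mul_sum, ← Finset.sum_sub_distrib]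
    exact Finset.sum_congr rfl fun u _ => by ring
  rw [h3]
  linarith [mul_le_mul_of_nonneg_left hc (mul_nonneg hθ (hw a))]

end Moments

/-! ### Exploration of the graph -/

/-- A state of the exploration: active vertices, undiscovered vertices, roots chosen so far. -/
structure State (n : ℕ) where
  A : Finset (Fin n)
  U : Finset (Fin n)
  R : Finset (Fin n)

/-- The state after revealing that `N` is the set of undiscovered neighbours of `a`. -/
def State.next {n : ℕ} (s : State n) (a : Fin n) (N : Finset (Fin n)) : State n :=
  ⟨s.A.erase a ∪ N, s.U \ N, s.R⟩

/-- The state after activating a new root `r`. -/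
def State.addRoot {n : ℕ} (s : State n) (r : Fin n) : State n :=
  ⟨{r}, s.U.erase r, insert r s.R⟩

/-- The number of steps an exploration from `s` can take. -/
def State.potential {n : ℕ} (s : State n) : ℕ := 2 * s.U.card + s.A.card

open Classical in
/-- One step of the exploration; new roots are chosen among the vertices in `mid`. -/
def State.step {n : ℕ} (mid : Set (Fin n)) (ω : Slot n → Bool) (s : State n) : State n :=
  if h : s.A.Nonempty then s.next h.choose (nbrs ω h.choose s.U)
  else if h : ∃ r ∈ s.U, r ∈ mid then s.addRoot h.choose else s

open Classical in
/-- The state reached by at most `k` steps, stopping at the first state in `Stop`. -/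
def State.run {n : ℕ} (mid : Set (Fin n)) (Stop : State n → Prop) (ω : Slot n → Bool) :
    ℕ → State n → State n
  | 0, s => s
  | k + 1, s => if Stop s then s else State.run mid Stop ω k (s.step mid ω)

section Explore
variable {n : ℕ} {mid : Set (Fin n)} {Stop : State n → Prop} {ω ω' : Slot n → Bool}

lemma State.step_cases (mid : Set (Fin n)) (ω : Slot n → Bool) (s : State n) :
    (∃ a ∈ s.A, s.step mid ω = s.next a (nbrs ω a s.U)) ∨
      (s.A = ∅ ∧ ∃ r ∈ s.U, r ∈ mid ∧ s.step mid ω = s.addRoot r) ∨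
      (s.A = ∅ ∧ (∀ r ∈ s.U, r ∉ mid) ∧ s.step mid ω = s) := by
  unfold State.step
  by_cases h : s.A.Nonempty
  · simp only [h, dif_pos]
    exact Or.inl ⟨_, h.choose_spec, rfl⟩
  · by_cases h' : ∃ r ∈ s.U, r ∈ mid
    · simp only [h, h', dif_pos, dif_neg, not_false_eq_true]
      exact Or.inr (Or.inl ⟨Finset.not_nonempty_iff_eq_empty.1 h, _, h'.choose_spec.1,
        h'.choose_spec.2, rfl⟩)
    · simp only [h, h', dif_neg, not_false_eq_true]
      push Not at h'
      exact Or.inr (Or.inr ⟨Finset.not_nonempty_iff_eq_empty.1 h, h', trivial⟩)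

lemma State.next_subset (s : State n) {a : Fin n} {N : Finset (Fin n)} (hN : N ⊆ s.U) :
    (s.next a N).A ∪ (s.next a N).U ⊆ s.A ∪ s.U := by
  intro v hv
  simp only [State.next, Finset.mem_union, Finset.mem_erase, Finset.mem_sdiff] at hv ⊢
  rcases hv with (h | h) | h
  · exact Or.inl h.2
  · exact Or.inr (hN h)
  · exact Or.inr h.1

lemma State.step_subset (mid : Set (Fin n)) (ω : Slot n → Bool) (s : State n) :
    (s.step mid ω).A ∪ (s.step mid ω).U ⊆ s.A ∪ s.U := by
  rcases s.step_cases mid ω with ⟨a, _, h⟩ | ⟨_, r, hr, _, h⟩ | ⟨_, _, h⟩ <;> rw [h]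
  · exact s.next_subset (nbrs_subset _ _ _)
  · intro v hv
    simp only [State.addRoot, Finset.mem_union, Finset.mem_singleton, Finset.mem_erase] at hv ⊢
    rcases hv with rfl | h
    · exact Or.inr hr
    · exact Or.inr h.2

lemma State.step_congr {s : State n} (h : ∀ e ∈ slotsIn (s.A ∪ s.U), ω e = ω' e) :
    s.step mid ω = s.step mid ω' := by
  unfold State.step
  split_ifs with hA hr
  · have ha := hA.choose_spec
    congr 1
    exact nbrs_congr fun u hu hau => h _ (slotOf_mem_slotsIn _ (Finset.mem_union_left _ ha)
      (Finset.mem_union_right _ hu))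
  · rfl
  · rfl

lemma State.run_subset (mid : Set (Fin n)) (Stop : State n → Prop) (ω : Slot n → Bool) (k : ℕ)
    (s : State n) :
    (s.run mid Stop ω k).A ∪ (s.run mid Stop ω k).U ⊆ s.A ∪ s.U := by
  induction k generalizing s with
  | zero => exact subset_rfl
  | succ k ih =>
    rw [State.run]
    split_ifs
    · exact subset_rfl
    · exact (ih _).trans (s.step_subset mid ω)

/-- `A ∪ U` only shrinks and each step consults only edges inside it, so explored vertices never
matter again. With `edgeLaw_nbrs_le` this provides the Markov property. -/
lemma State.run_congr (k : ℕ) {s : State n} (h : ∀ e ∈ slotsIn (s.A ∪ s.U), ω e = ω' e) :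
    s.run mid Stop ω k = s.run mid Stop ω' k := by
  induction k generalizing s with
  | zero => rfl
  | succ k ih =>
    simp only [State.run]
    split_ifs
    · rfl
    · rw [State.step_congr h]
      exact ih fun e he => h e (slotsIn_mono (s.step_subset mid ω') he)

/-- Optional stopping for the exploration: if `Ψ` is a nonnegative supermartingale up to the
stopping time which dominates the probability of failure there, then it dominates the probability
of failure. -/
theorem edgeLaw_run_le (w : Fin n → ℝ) (p : ℝ) (mid : Set (Fin n)) (Stop : State n → Prop)
    (Ψ : State n → ℝ) (Fail : State n → Set (Slot n → Bool))
    (hdisj : ∀ s, ¬ Stop s → Disjoint s.A s.U)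
    (hdet : ∀ s, DeterminedBy (slotsIn (s.A ∪ s.U)) (Fail s))
    (h0 : ∀ s, 0 ≤ Ψ s)
    (hend : ∀ s, Stop s → (edgeLaw w p).real (Fail s) ≤ Ψ s)
    (hroot : ∀ s r, ¬ Stop s → s.A = ∅ → r ∈ s.U → Ψ (s.addRoot r) ≤ Ψ s)
    (hstep : ∀ s a, ¬ Stop s → a ∈ s.A →
      ∫ ω, Ψ (s.next a (nbrs ω a s.U)) ∂(edgeLaw w p) ≤ Ψ s)
    (k : ℕ) (s : State n) :
    (edgeLaw w p).real {ω | Stop (s.run mid Stop ω k) ∧ ω ∈ Fail (s.run mid Stop ω k)} ≤ Ψ s := by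
  have hend' : ∀ s, Stop s → ∀ k,
      (edgeLaw w p).real {ω | Stop (s.run mid Stop ω k) ∧ ω ∈ Fail (s.run mid Stop ω k)}
        ≤ Ψ s := by
    intro s hs k
    have : ∀ ω, s.run mid Stop ω k = s := by
      intro ω
      cases k with
      | zero => rfl
      | succ k => rw [State.run, if_pos hs]
    simp_rw [this]
    simpa [hs] using hend s hs
  induction k generalizing s with
  | zero =>
    by_cases hs : Stop s
    · exact hend' s hs 0
    · simpa [State.run, hs] using h0 s
  | succ k ih =>
    by_cases hs : Stop s
    · exact hend' s hs _
    simp only [State.run, hs, if_false]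
    by_cases hA : s.A.Nonempty
    · set a := hA.choose with ha
      have haA : a ∈ s.A := hA.choose_spec
      have haU : a ∉ s.U := Finset.disjoint_left.1 (hdisj s hs) haA
      have hst : ∀ ω, s.step mid ω = s.next a (nbrs ω a s.U) := by
        intro ω; simp only [State.step, hA, dif_pos, ha]
      simp_rw [hst]
      refine le_trans ?_ (hstep s a hs haA)
      -- The slots at `a` are now spent: the rest of the run and the failure event live on `A ∪ U`
      -- without `a`, so they are independent of the neighbourhood just revealed, and the induction
      -- hypothesis applies for each of its values.
      refine edgeLaw_nbrs_le w p (W := (s.A ∪ s.U).erase a) (Finset.notMem_erase _ _)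
        (fun N => {ω | Stop ((s.next a N).run mid Stop ω k) ∧
          ω ∈ Fail ((s.next a N).run mid Stop ω k)}) ?_ (fun N => Ψ (s.next a N))
        (fun N _ => ih _)
      intro N hN ω ω' hω
      have hsub : (s.next a N).A ∪ (s.next a N).U ⊆ (s.A ∪ s.U).erase a := by
        intro v hv
        refine Finset.mem_erase.2 ⟨?_, s.next_subset hN hv⟩
        intro hva
        rw [hva] at hv
        simp only [State.next, Finset.mem_union, Finset.mem_erase, Finset.mem_sdiff] at hv
        have := @hN a
        tauto
      have hrun := State.run_congr (mid := mid) (Stop := Stop) k (s := s.next a N)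
        fun e he => hω e (slotsIn_mono hsub he)
      rintro ⟨h1, h2⟩
      refine ⟨hrun ▸ h1, ?_⟩
      rw [← hrun]
      exact hdet _ ω ω' (fun e he => hω e (slotsIn_mono
        ((State.run_subset mid Stop ω k _).trans hsub) he)) h2
    · have hA' := Finset.not_nonempty_iff_eq_empty.1 hA
      by_cases hr : ∃ r ∈ s.U, r ∈ mid
      · have hst : ∀ ω, s.step mid ω = s.addRoot hr.choose := by
          intro ω; simp only [State.step, hA, hr, dif_pos, dif_neg, not_false_eq_true]
        simp_rw [hst]
        exact (ih _).trans (hroot s _ hs hA' hr.choose_spec.1)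
      · have hst : ∀ ω, s.step mid ω = s := by
          intro ω; simp only [State.step, hA, hr, dif_neg, not_false_eq_true]
        simp_rw [hst]
        exact ih s

lemma State.run_induct {P : State n → Prop} (hP : ∀ s, ¬ Stop s → P s → P (s.step mid ω)) (k : ℕ)
    {s : State n} (hs : P s) : P (s.run mid Stop ω k) := by
  induction k generalizing s with
  | zero => exact hs
  | succ k ih =>
    rw [State.run]
    split_ifs with h
    · exact hs
    · exact ih (hP s h hs)

/-- Undiscovered vertices count twice, so a move from `U` to `A` still lowers the potential, as does
the removal of `a`. -/
lemma State.potential_next {s : State n} {a : Fin n} {N : Finset (Fin n)} (ha : a ∈ s.A)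
    (hN : N ⊆ s.U) : (s.next a N).potential < s.potential := by
  have h1 := Finset.card_union_le (s.A.erase a) N
  have h2 := Finset.card_erase_of_mem ha
  have h3 := Finset.card_pos.2 ⟨a, ha⟩
  have h4 := Finset.card_sdiff_of_subset hN
  have h5 := Finset.card_le_card hN
  simp only [State.potential, State.next]
  omega

lemma State.potential_addRoot {s : State n} {r : Fin n} (hr : r ∈ s.U) :
    (s.addRoot r).potential < s.potential := by
  have h2 := Finset.card_erase_of_mem hr
  have h3 := Finset.card_pos.2 ⟨r, hr⟩
  simp only [State.potential, State.addRoot, Finset.card_singleton]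
  omega

/-- An exploration that cannot get stuck stops. -/
lemma State.terminates {P : State n → Prop} (hP : ∀ s, ¬ Stop s → P s → P (s.step mid ω))
    (hprog : ∀ s, ¬ Stop s → P s → s.A = ∅ → ∃ r ∈ s.U, r ∈ mid) {k : ℕ}
    {s : State n} (hs : P s) (hk : s.potential ≤ k) : Stop (s.run mid Stop ω k) := by
  have hlt : ∀ s, ¬ Stop s → P s → (s.step mid ω).potential < s.potential := by
    intro s hst hs
    rcases s.step_cases mid ω with ⟨a, ha, h⟩ | ⟨_, r, hr, _, h⟩ | ⟨hA, hno, h⟩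
    · rw [h]; exact State.potential_next ha (nbrs_subset _ _ _)
    · rw [h]; exact State.potential_addRoot hr
    · obtain ⟨r, hr, hm⟩ := hprog s hst hs hA
      exact absurd hm (hno r hr)
  induction k generalizing s with
  | zero =>
    by_contra hst
    have := hlt s hst hs
    omega
  | succ k ih =>
    rw [State.run]
    split_ifs with h
    · exact h
    · exact ih (hP s h hs) (by have := hlt s h hs; omega)

end Explore

/-! ### Clusters inside a vertex set -/

lemma mem_of_reachable {V : Type*} {G : SimpleGraph V} {S : Set V} {v x : V}
    (hS : ∀ a b, a ∈ S → G.Adj a b → b ∈ S) (hv : v ∈ S) (h : G.Reachable v x) : x ∈ S := by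
  obtain ⟨q⟩ := h
  induction q with
  | nil => exact hv
  | cons hadj _ ih => exact ih (hS _ _ hv hadj)

/-- The graph `G` with only the edges inside `U` kept. -/
def within {n : ℕ} (G : SimpleGraph (Fin n)) (U : Finset (Fin n)) : SimpleGraph (Fin n) where
  Adj a b := G.Adj a b ∧ a ∈ U ∧ b ∈ U
  symm := ⟨fun _ _ h => ⟨h.1.symm, h.2.2, h.2.1⟩⟩
  loopless := ⟨fun _ h => G.loopless.irrefl _ h.1⟩

open Classical in
/-- The vertices that can be reached from `v` inside `U`. -/
def cluster {n : ℕ} (G : SimpleGraph (Fin n)) (U : Finset (Fin n)) (v : Fin n) :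
    Finset (Fin n) := Finset.univ.filter fun x => (within G U).Reachable v x

lemma mem_cluster {n : ℕ} {G : SimpleGraph (Fin n)} {U : Finset (Fin n)} {v x : Fin n} :
    x ∈ cluster G U v ↔ (within G U).Reachable v x := by simp [cluster]

lemma cluster_subset {n : ℕ} {G : SimpleGraph (Fin n)} {U : Finset (Fin n)} {v : Fin n}
    (hv : v ∈ U) : cluster G U v ⊆ U := fun _ hx =>
  mem_of_reachable (G := within G U) (S := (U : Set (Fin n))) (fun _ _ _ h => h.2.2) hv
    (mem_cluster.1 hx)

lemma cluster_eq {n : ℕ} {G : SimpleGraph (Fin n)} {U : Finset (Fin n)} {v x : Fin n}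
    (hx : x ∈ cluster G U v) : cluster G U x = cluster G U v := by
  ext y
  rw [mem_cluster] at hx
  rw [mem_cluster, mem_cluster]
  exact ⟨fun h => hx.trans h, fun h => hx.symm.trans h⟩

/-- Some cluster inside `U` has at least `m` vertices. -/
def bigCluster {n : ℕ} (U : Finset (Fin n)) (m : ℝ) : Set (Slot n → Bool) :=
  {ω | ∃ v ∈ U, m ≤ (cluster (graphOf ω) U v).card}

lemma determinedBy_bigCluster {n : ℕ} (U : Finset (Fin n)) (m : ℝ) :
    DeterminedBy (slotsIn U) (bigCluster U m) := by
  rintro ω ω' h ⟨v, hv, hm⟩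
  have : within (graphOf ω) U = within (graphOf ω') U := by
    ext a b
    simp only [within]
    refine and_congr_left fun hab => adj_congr fun hne => h _ (slotOf_mem_slotsIn hne hab.1 hab.2)
  refine ⟨v, hv, ?_⟩
  rwa [cluster, ← this]

/-! ### Cluster sizes in subcritical graphs -/

section Subcritical
variable {n : ℕ} {w : Fin n → ℝ} {p : ℝ}

lemma State.sum_next {s : State n} (hd : Disjoint s.A s.U) {a : Fin n} (ha : a ∈ s.A)
    {N : Finset (Fin n)} (hN : N ⊆ s.U) (g : Fin n → ℝ) :
    ∑ v ∈ (s.next a N).A, g v = ∑ v ∈ s.A, g v - g a + ∑ v ∈ N, g v := by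
  rw [State.next, Finset.sum_union, Finset.sum_erase_eq_sub ha]
  exact (hd.mono_left (Finset.erase_subset _ _)).mono_right hN

/-- Explore from `v` and let `E` be `θ` times the active weight plus `γ` times the number
discovered. Hypothesis `hc` says that the `θ w_a` lost with `a` pays for the exponential gain from
its neighbours, so `exp E` is a supermartingale, and `E ≥ γ m` once `m` vertices are discovered.
Subtracting 1 from the exponential keeps the bound for a single `v` of order `θ w_v + γ`, which
matters when summing over `v`. -/
lemma edgeLaw_card_cluster_le (hw : ∀ i, 0 ≤ w i) (hp : 0 ≤ p) {U₀ : Finset (Fin n)} {θ γ m : ℝ}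
    (hθ : 0 ≤ θ) (hγ : 0 < γ) (hm : 0 < m) (h1 : ∀ u, θ * w u + γ ≤ 1)
    (hc : p * (∑ u ∈ U₀, w u * (θ * w u + γ) + ∑ u ∈ U₀, w u * (θ * w u + γ) ^ 2) ≤ θ)
    {v : Fin n} (hv : v ∈ U₀) :
    (edgeLaw w p).real {ω | m ≤ (cluster (graphOf ω) U₀ v).card}
      ≤ (Real.exp (θ * w v + γ) - 1) / (Real.exp (γ * m) - 1) := by
  have hD : 0 < Real.exp (γ * m) - 1 := by
    have := Real.add_one_lt_exp (mul_pos hγ hm).ne'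
    nlinarith [mul_pos hγ hm]
  have hg0 : ∀ u, 0 ≤ θ * w u + γ := fun u => add_nonneg (mul_nonneg hθ (hw u)) hγ.le
  let Stop : State n → Prop := fun s =>
    ¬ Disjoint s.A s.U ∨ ¬ s.U ⊆ U₀ ∨ s.A = ∅ ∨ m ≤ ((U₀ \ s.U).card : ℝ)
  let E : State n → ℝ := fun s => θ * ∑ v ∈ s.A, w v + γ * (U₀ \ s.U).card
  let Ψ : State n → ℝ := fun s => (Real.exp (E s) - 1) / (Real.exp (γ * m) - 1)
  let Fail : State n → Set (Slot n → Bool) := fun s => {_ω | m ≤ ((U₀ \ s.U).card : ℝ)}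
  have hE0 : ∀ s, γ * (U₀ \ s.U).card ≤ E s := fun s => by
    have : 0 ≤ θ * ∑ v ∈ s.A, w v := mul_nonneg hθ (Finset.sum_nonneg fun i _ => hw i)
    simp only [E]; linarith
  have hΨ0 : ∀ s, 0 ≤ Ψ s := fun s => by
    refine div_nonneg ?_ hD.le
    have : 0 ≤ E s := le_trans (by positivity) (hE0 s)
    simpa using this
  have hstep : ∀ s a, ¬ Stop s → a ∈ s.A →
      ∫ ω, Ψ (s.next a (nbrs ω a s.U)) ∂(edgeLaw w p) ≤ Ψ s := by
    intro s a hs ha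
    simp only [Stop, not_or, not_not] at hs
    obtain ⟨hd, hU, -, -⟩ := hs
    have haU : a ∉ s.U := Finset.disjoint_left.1 hd ha
    have hE : ∀ ω, E (s.next a (nbrs ω a s.U))
        = E s + 1 * (∑ u ∈ nbrs ω a s.U, (θ * w u + γ) - θ * w a) := by
      intro ω
      have hN := nbrs_subset ω a s.U
      have hcard : ((U₀ \ (s.next a (nbrs ω a s.U)).U).card : ℝ)
          = (U₀ \ s.U).card + (nbrs ω a s.U).card := by
        have : U₀ \ (s.U \ nbrs ω a s.U) = (U₀ \ s.U) ∪ nbrs ω a s.U := by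
          ext x
          have h1 := @hN x
          have h2 := @hU x
          simp only [Finset.mem_sdiff, Finset.mem_union]
          tauto
        rw [State.next, this, Finset.card_union_of_disjoint, Nat.cast_add]
        exact Finset.sdiff_disjoint.mono_right hN
      simp only [E]
      rw [hcard, State.sum_next hd ha hN, Finset.sum_add_distrib, ← Finset.mul_sum,
        Finset.sum_const, nsmul_eq_mul]
      ring
    have key := integral_exp_nbrs_le_one (w := w) (p := p) hw hp haU hg0 zero_le_one
      (c := θ) (fun u => by simpa using h1 u) (by
        refine le_trans (mul_le_mul_of_nonneg_left ?_ hp) hc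
        rw [one_mul]
        refine add_le_add ?_ ?_ <;> refine Finset.sum_le_sum_of_subset_of_nonneg hU ?_
        · exact fun u _ _ => mul_nonneg (hw u) (hg0 u)
        · exact fun u _ _ => mul_nonneg (hw u) (sq_nonneg _))
    have : ∀ ω, Ψ (s.next a (nbrs ω a s.U)) = (Real.exp (E s) *
        Real.exp (1 * (∑ u ∈ nbrs ω a s.U, (θ * w u + γ) - θ * w a)) - 1)
          / (Real.exp (γ * m) - 1) := by
      intro ω; simp only [Ψ]; rw [hE, Real.exp_add]
    simp_rw [this]
    rw [integral_div, integral_sub (integrable_edgeLaw w p _) (integrable_const _),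
      integral_const_mul]
    simp only [integral_const, probReal_univ, smul_eq_mul, mul_one]
    refine div_le_div_of_nonneg_right ?_ hD.le
    have := mul_le_mul_of_nonneg_left key (Real.exp_pos (E s)).le
    linarith
  let s₀ : State n := ⟨{v}, U₀.erase v, ∅⟩
  -- No vertex may serve as a new root: only the cluster of `v` is explored, and an empty active set
  -- stops the run.
  have key := edgeLaw_run_le w p ∅ Stop Ψ Fail
    (fun s hs => by simp only [Stop, not_or, not_not] at hs; exact hs.1)
    (fun s ω ω' _ h => h) hΨ0
    (fun s hs => by
      by_cases h : m ≤ ((U₀ \ s.U).card : ℝ)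
      · have : 1 ≤ Ψ s := by
          rw [le_div_iff₀ hD, one_mul]
          have := (mul_le_mul_of_nonneg_left h hγ.le).trans (hE0 s)
          linarith [Real.exp_le_exp.2 this]
        exact measureReal_le_one.trans this
      · have : Fail s = ∅ := by ext; simp [Fail, h]
        rw [this]; simpa using hΨ0 s)
    (fun s r hs hA _ => by simp [Stop, hA] at hs)
    hstep s₀.potential s₀
  have hs₀ : Ψ s₀ = (Real.exp (θ * w v + γ) - 1) / (Real.exp (γ * m) - 1) := by
    have : U₀ \ U₀.erase v = {v} := by
      ext x; simp only [Finset.mem_sdiff, Finset.mem_erase, Finset.mem_singleton]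
      constructor
      · tauto
      · rintro rfl; exact ⟨hv, by simp⟩
    simp only [Ψ, E, s₀, this, Finset.sum_singleton, Finset.card_singleton]
    simp
  rw [← hs₀]
  refine le_trans (measureReal_mono fun ω (hω : m ≤ _) => ?_) key
  -- The invariant says that explored vertices have no undiscovered neighbours. When no vertex is
  -- active, the cluster of `v` is therefore contained in the discovered set.
  set P : State n → Prop := fun s => Disjoint s.A s.U ∧ s.A ∪ s.U ⊆ U₀ ∧ v ∉ s.U ∧
    ∀ x ∈ U₀ \ (s.A ∪ s.U), ∀ u ∈ s.U, ¬ (graphOf ω).Adj x u with hPdef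
  have hPs₀ : P s₀ := by
    refine ⟨by simp [s₀], ?_, by simp [s₀], ?_⟩
    · intro x; simp only [s₀, Finset.mem_union, Finset.mem_singleton, Finset.mem_erase]
      rintro (rfl | h)
      · exact hv
      · exact h.2
    · intro x hx
      simp only [s₀, Finset.mem_union, Finset.mem_singleton, Finset.mem_erase,
        Finset.mem_sdiff] at hx
      tauto
  have hP : ∀ s, ¬ Stop s → P s → P (s.step ∅ ω) := by
    intro s hs ⟨hd, hU, hvU, hcl⟩
    simp only [Stop, not_or, not_not] at hs
    rcases s.step_cases ∅ ω with ⟨a, ha, h⟩ | ⟨_, r, _, hr, _⟩ | ⟨hA, _, _⟩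
    · rw [h]
      have hN := nbrs_subset ω a s.U
      refine ⟨?_, (s.next_subset hN).trans hU, ?_, ?_⟩
      · rw [State.next, Finset.disjoint_union_left]
        exact ⟨(hd.mono_left (Finset.erase_subset _ _)).mono_right Finset.sdiff_subset,
          Finset.disjoint_sdiff⟩
      · simp [State.next, hvU]
      · intro x hx u hu hadj
        simp only [State.next, Finset.mem_union, Finset.mem_erase, Finset.mem_sdiff] at hx hu
        by_cases hxa : x = a
        · subst hxa
          exact hu.2 (mem_nbrs.2 ⟨hu.1, hadj⟩)
        · refine hcl x ?_ u hu.1 hadj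
          simp only [Finset.mem_union, Finset.mem_sdiff]
          tauto
    · exact absurd hr (Set.notMem_empty _)
    · exact absurd hA hs.2.2.1
  have hfinP : P (s₀.run ∅ Stop ω s₀.potential) := State.run_induct hP _ hPs₀
  have hfinS : Stop (s₀.run ∅ Stop ω s₀.potential) := State.terminates hP
    (fun s hs _ hA => by simp [Stop, hA] at hs) hPs₀ le_rfl
  refine ⟨hfinS, ?_⟩
  generalize s₀.run ∅ Stop ω s₀.potential = s at hfinP hfinS
  obtain ⟨hd, hU, hvU, hcl⟩ := hfinP
  rcases hfinS with h | h | hA | h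
  · exact absurd hd h
  · exact absurd (Finset.subset_union_right.trans hU) h
  · refine le_trans hω ?_
    have : cluster (graphOf ω) U₀ v ⊆ U₀ \ s.U := by
      intro x hx
      have := mem_of_reachable (S := ((U₀ \ s.U : Finset (Fin n)) : Set (Fin n))) (v := v) ?_ ?_
        (mem_cluster.1 hx)
      · exact this
      · intro a b ha hab
        simp only [Finset.coe_sdiff, Set.mem_sdiff, Finset.mem_coe] at ha ⊢
        refine ⟨hab.2.2, fun hb => hcl a ?_ b hb hab.1⟩
        simpa [hA] using ha
      · simp [hv, hvU]
    exact_mod_cast Finset.card_le_card this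
  · exact h

/-- In a subcritical rank-1 graph all clusters are small. -/
theorem edgeLaw_bigCluster_le (hw : ∀ i, 0 ≤ w i) (hp : 0 ≤ p) {U₀ : Finset (Fin n)}
    {θ γ m : ℝ} (hθ : 0 ≤ θ) (hγ : 0 < γ) (hm : 0 < m) (h1 : ∀ u, θ * w u + γ ≤ 1)
    (hc : p * (∑ u ∈ U₀, w u * (θ * w u + γ) + ∑ u ∈ U₀, w u * (θ * w u + γ) ^ 2) ≤ θ) :
    (edgeLaw w p).real (bigCluster U₀ m)
      ≤ (∑ v ∈ U₀, (Real.exp (θ * w v + γ) - 1) / (Real.exp (γ * m) - 1)) / m := by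
  set μ := edgeLaw w p
  have hms : ∀ E : Set (Slot n → Bool), MeasurableSet E := fun E => (Set.toFinite E).measurableSet
  rw [le_div_iff₀ hm]
  -- Double counting: a cluster with at least `m` vertices is seen from each of them, which gains a
  -- factor `m` over the union bound.
  have h2 : μ.real (bigCluster U₀ m) * m
      ≤ ∑ v ∈ U₀, μ.real {ω | m ≤ (cluster (graphOf ω) U₀ v).card} := by
    have h3 : μ.real (bigCluster U₀ m) * m
        = ∫ ω, (bigCluster U₀ m).indicator (fun _ => m) ω ∂μ := by
      rw [integral_indicator_const _ (hms _), smul_eq_mul]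
    have h4 : ∑ v ∈ U₀, μ.real {ω | m ≤ (cluster (graphOf ω) U₀ v).card}
        = ∫ ω, ∑ v ∈ U₀, Set.indicator {ω | m ≤ (cluster (graphOf ω) U₀ v).card}
            (fun _ => (1 : ℝ)) ω ∂μ := by
      rw [integral_finsetSum _ fun _ _ => integrable_edgeLaw w p _]
      refine Finset.sum_congr rfl fun v _ => ?_
      rw [integral_indicator_const _ (hms _), smul_eq_mul, mul_one]
    rw [h3, h4]
    refine integral_mono (integrable_edgeLaw w p _) (integrable_edgeLaw w p _) fun ω => ?_
    by_cases hω : ω ∈ bigCluster U₀ m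
    · obtain ⟨v, hv, hmv⟩ := id hω
      simp only [Set.indicator_of_mem hω]
      calc m ≤ ((cluster (graphOf ω) U₀ v).card : ℝ) := hmv
        _ = ∑ x ∈ cluster (graphOf ω) U₀ v,
            Set.indicator {ω | m ≤ (cluster (graphOf ω) U₀ x).card} (fun _ => (1 : ℝ)) ω := by
          rw [Finset.sum_congr rfl (g := fun _ => (1 : ℝ))]
          · simp
          · intro x hx
            rw [Set.indicator_of_mem]
            rw [Set.mem_ofPred_eq, cluster_eq hx]
            exact hmv
        _ ≤ _ := Finset.sum_le_sum_of_subset_of_nonneg (cluster_subset hv)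
            fun _ _ _ => Set.indicator_nonneg (fun _ _ => zero_le_one) _
    · simp only [Set.indicator_of_notMem hω]
      exact Finset.sum_nonneg fun _ _ => Set.indicator_nonneg (fun _ _ => zero_le_one) _
  exact h2.trans (Finset.sum_le_sum fun v hv =>
    edgeLaw_card_cluster_le hw hp hθ hγ hm h1 hc hv)

end Subcritical

/-! ### The supercritical exploration -/

/-- The weights together with the constants used to control the exploration. -/
structure Setup (n : ℕ) where
  w : Fin n → ℝ
  -- `lam` stands for `ℓ^(1/3)`. Of the error parameters, `η` is the relative error allowed in the
  -- answer and `δ` that of the drifts; `K` truncates the third moment, and `κ` bounds the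
  -- quantities that vanish as `n` grows. They are chosen in the order `η`, `δ`, `K`, `κ`.
  lam : ℝ
  f : ℝ
  C : ℝ
  c₁ : ℝ
  c₂ : ℝ
  c₃ : ℝ
  c₄ : ℝ
  η : ℝ
  δ : ℝ
  K : ℝ
  κ : ℝ

namespace Setup
variable {n : ℕ} (S : Setup n)

/-- The total weight. -/
def ell : ℝ := S.lam ^ 3
/-- The relative excess of the edge parameter over its critical value. -/
def u : ℝ := S.f / S.lam
/-- The edge parameter. -/
def p : ℝ := (S.lam + S.f) / S.lam ^ 4
/-- The expected weight of the giant component. -/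
def x : ℝ := 2 * S.u * S.ell / S.C
/-- The error allowed for the slope of the exploration walk, relative to `u`. -/
def η₁ : ℝ := S.δ * (4 / S.C + 6)
/-- The vertices of typical weight, among which the roots are chosen. -/
def mid : Set (Fin n) := {i | S.c₁ ≤ S.w i ∧ S.w i ≤ S.c₂}

/-- The relations between the constants. -/
structure ConstValid : Prop where
  C_pos : 0 < S.C
  c₁_pos : 0 < S.c₁
  c₂_pos : 0 < S.c₂
  η_pos : 0 < S.η
  η_le : S.η ≤ 1 / 100
  δ_pos : 0 < S.δ
  δ_le_one : S.δ ≤ 1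
  δ_le_C : S.δ ≤ S.C / 4
  δ_η : S.δ * (2 + S.C / 2) ≤ S.η
  η₁_η : 4 * S.η₁ / S.C + 2 * S.δ ≤ 2 * S.η / S.C
  K_pos : 0 < S.K
  κ_pos : 0 < S.κ
  κ_le : S.κ ≤ 1 / 4
  κ_δ : 7 * S.κ ≤ S.δ
  -- From here on each inequality holds for small `κ` with the other constants fixed. The subscripts
  -- 2, 0, 1 refer to the sums of `w²`, `1`, `w`, whose drifts are bounded from above (`up`) and
  -- below (`low`).
  κ_up₂ : (1 + S.κ) * (S.C + S.κ) * (1 + S.κ ^ 2 / S.δ) ≤ S.C + S.δ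
  κ_low₂ : S.κ + 7 * S.K * S.κ + (2 * S.κ ^ 2 + S.κ ^ 2 / S.δ) * (S.C + S.κ) ≤ 3 * S.δ / 4
  κ_up₀ : (1 + S.κ) * (1 + S.κ ^ 2 / S.δ) ≤ 1 + S.δ
  κ_low₀ : 6 * S.κ / S.C + 4 * S.κ + S.κ ^ 2 / S.δ ≤ S.δ
  κ_up₁ : 2 * S.κ + S.C * S.κ ≤ S.δ
  κ_low₁ : 2 * S.κ + 4 * (S.C + S.κ) * S.κ ≤ S.δ
  κ_c₂ : S.c₂ * S.κ ≤ S.δ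
  κ_c₂' : 2 * S.c₂ * S.κ / S.C ≤ S.δ
  κ_c₁ : S.κ ≤ S.c₁
  κ_c₃ : 6 * S.κ / S.C < S.c₃
  κ_c₄ : S.c₄ * S.κ ≤ 1

/-- The conditions on the weights and on `f`. -/
structure Valid : Prop extends S.ConstValid where
  w_pos : ∀ i, 0 < S.w i
  lam_pos : 0 < S.lam
  one_le_f : 1 ≤ S.f
  -- This makes the variance correction to the drift of the weights at most of order `δ u`. The next
  -- bound is for the subcritical phase, where the gap `u/2` must beat quadratic terms.
  f_sq : 2 * (S.C + 1) ≤ S.δ ^ 2 * S.f ^ 2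
  f_C : 32 * (S.C + 1) ≤ S.f
  f_le : S.f ≤ S.κ * S.lam
  w_le : ∀ i, S.w i ≤ S.κ * S.lam
  sum_one : ∑ i, S.w i = S.lam ^ 3
  sum_two : |∑ i, S.w i ^ 2 - S.lam ^ 3| ≤ S.κ * S.lam ^ 2
  sum_three : |∑ i, S.w i ^ 3 - S.C * S.lam ^ 3| ≤ S.κ * S.lam ^ 3
  tail : ∑ i with S.K < S.w i, S.w i ^ 3 ≤ S.δ / 4 * S.lam ^ 3
  mid_card : S.c₃ * S.lam ^ 3 ≤ S.mid.ncard
  card_le : (n : ℝ) ≤ S.c₄ * S.lam ^ 3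

/-- The weight explored so far. -/
def time (s : State n) : ℝ := ∑ v ∈ (s.A ∪ s.U)ᶜ, S.w v

/-- The sum of `g` over the discovered vertices that are not roots. -/
def disc (g : Fin n → ℝ) (s : State n) : ℝ := ∑ v ∈ s.Uᶜ, g v - ∑ v ∈ s.R, g v

/-- The expected path of `disc w`. -/
def path (c t : ℝ) : ℝ := (1 + S.u + c) * t - S.C * t ^ 2 / (2 * S.ell)

/-- The deviations of the exploration from its expected path. -/
def dev (s : State n) : Fin 6 → ℝ
  -- The six entries are upper and lower deviations of the discovered sums of `w²`, `1` and `w`. The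
  -- first four are measured against straight lines, the last two against the parabola.
  | 0 => disc (fun v => S.w v ^ 2) s - (S.C + S.δ) * S.time s
  | 1 => -(disc (fun v => S.w v ^ 2) s - (S.C - S.δ) * S.time s)
  | 2 => disc (fun _ => 1) s - (1 + S.δ) * S.time s
  | 3 => -(disc (fun _ => 1) s - (1 - S.δ) * S.time s)
  | 4 => disc S.w s - S.path (S.η₁ * S.u) (S.time s)
  | 5 => -(disc S.w s - S.path (-(S.η₁ * S.u)) (S.time s))

/-- The exponential rates at which the deviations are tested. -/
def rate : Fin 6 → ℝ
  -- Control is lost when a deviation reaches `f / rate`: this is `δ u ℓ` here, comparable to `x`,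
  -- and `δ u² ℓ` for the weights, comparable to the height `u x` of the excursion.
  | 0 | 1 | 2 | 3 => 1 / (S.δ * S.lam ^ 2)
  | 4 | 5 => 1 / (S.δ * S.f * S.lam)

/-- The exponents of the supermartingales. -/
def expo (s : State n) (i : Fin 6) : ℝ := S.rate i * S.dev s i - S.f

/-- The structural properties of the states that are met. -/
structure Struct (s : State n) : Prop where
  disjoint_AU : Disjoint s.A s.U
  disjoint_RU : Disjoint s.R s.U
  root_mid : ∀ r ∈ s.R, r ∈ S.mid
  root_weight : ∑ r ∈ s.R, S.w r ≤ S.η * S.u * S.x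

/-- The states at which the exploration is under control. -/
structure Good (s : State n) : Prop extends S.Struct s where
  ctrl : ∀ i, S.expo s i < 0

variable {S}

/-! ### Elementary bounds, and the effect of one step on the explored and discovered sums -/

namespace Valid
variable (h : S.Valid)
include h

lemma f_pos : 0 < S.f := lt_of_lt_of_le one_pos h.one_le_f
lemma one_le_κ_lam : 1 ≤ S.κ * S.lam := h.one_le_f.trans h.f_le
lemma one_le_lam : 1 ≤ S.lam := by
  have := h.one_le_κ_lam; have := h.κ_le; have := h.lam_pos
  nlinarith
lemma u_pos : 0 < S.u := div_pos h.f_pos h.lam_pos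
lemma ell_pos : 0 < S.ell := pow_pos h.lam_pos 3
lemma u_le : S.u ≤ S.κ := (div_le_iff₀ h.lam_pos).2 h.f_le
lemma u_mul_lam : S.u * S.lam = S.f := div_mul_cancel₀ _ h.lam_pos.ne'
lemma u_mul_ell : S.u * S.ell = S.f * S.lam ^ 2 := by
  rw [← h.u_mul_lam, ell]; ring
lemma lam_sq_le : S.lam ^ 2 ≤ S.u * S.ell := by
  rw [h.u_mul_ell]; nlinarith [h.one_le_f, sq_nonneg S.lam]
lemma lam_le : S.lam ≤ S.u * S.ell := by
  refine le_trans ?_ h.lam_sq_le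
  nlinarith [h.one_le_lam]
lemma p_eq : S.p = (1 + S.u) / S.ell := by
  have := h.lam_pos
  rw [p, u, ell]; field_simp
lemma p_pos : 0 < S.p := by
  rw [h.p_eq]; exact div_pos (by linarith [h.u_pos]) h.ell_pos
lemma x_pos : 0 < S.x := div_pos (mul_pos (mul_pos two_pos h.u_pos) h.ell_pos) h.C_pos
lemma C_mul_x : S.C * S.x = 2 * (S.u * S.ell) := by
  rw [x, mul_div_cancel₀ _ h.C_pos.ne']; ring
lemma η₁_pos : 0 < S.η₁ := by
  have := h.C_pos; have := h.δ_pos; unfold η₁; positivity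
lemma four_η₁ : 4 * S.η₁ + 2 * S.δ * S.C ≤ 2 * S.η := by
  have h1 := mul_le_mul_of_nonneg_right h.η₁_η h.C_pos.le
  have := h.C_pos
  have h2 : (4 * S.η₁ / S.C + 2 * S.δ) * S.C = 4 * S.η₁ + 2 * S.δ * S.C := by field_simp
  have h3 : 2 * S.η / S.C * S.C = 2 * S.η := by field_simp
  linarith
-- Once the clock `t` is subtracted, this form exhibits the zeros 0 and `x` of the parabola.
lemma path_eq (c t : ℝ) : S.path c t = (1 + c) * t + S.u * t * (1 - t / S.x) := by
  have := h.C_pos; have := h.ell_pos; have := h.u_pos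
  rw [path, x]; field_simp; ring
lemma w_nonneg (i : Fin n) : 0 ≤ S.w i := (h.w_pos i).le

lemma sum_weight_nonneg (X : Finset (Fin n)) : 0 ≤ ∑ v ∈ X, S.w v :=
  Finset.sum_nonneg fun i _ => h.w_nonneg i

lemma time_nonneg (s : State n) : 0 ≤ S.time s := Finset.sum_nonneg fun i _ => h.w_nonneg i

end Valid

lemma sum_compl_U {s : State n} (hs : Disjoint s.A s.U) (g : Fin n → ℝ) :
    ∑ v ∈ s.Uᶜ, g v = ∑ v ∈ (s.A ∪ s.U)ᶜ, g v + ∑ v ∈ s.A, g v := by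
  rw [← Finset.sum_union]
  · congr 1
    ext v
    have := fun hv : v ∈ s.A => Finset.disjoint_left.1 hs hv
    simp only [Finset.mem_compl, Finset.mem_union]
    tauto
  · rw [Finset.disjoint_left]
    intro v hv hA
    simp [hA] at hv

/-- Discovered vertices are explored or active, so discovered weight minus the clock is the
exploration walk: active weight minus root weight. -/
lemma disc_weight {s : State n} (hs : Disjoint s.A s.U) :
    disc S.w s = S.time s + ∑ v ∈ s.A, S.w v - ∑ v ∈ s.R, S.w v := by
  rw [disc, sum_compl_U hs, time]

lemma time_next {s : State n} (hs : Disjoint s.A s.U) {a : Fin n} (ha : a ∈ s.A)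
    {N : Finset (Fin n)} (hN : N ⊆ s.U) : S.time (s.next a N) = S.time s + S.w a := by
  rw [time, time, add_comm, ← Finset.sum_insert]
  · congr 1
    ext v
    have h1 := fun hv : v ∈ s.A => Finset.disjoint_left.1 hs hv
    have h2 := @hN v
    simp only [State.next, Finset.mem_compl, Finset.mem_union, Finset.mem_erase,
      Finset.mem_sdiff, Finset.mem_insert]
    by_cases hv : v = a
    · subst hv; tauto
    · tauto
  · simp [ha]

lemma disc_next (g : Fin n → ℝ) {s : State n} {a : Fin n} {N : Finset (Fin n)} (hN : N ⊆ s.U) :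
    disc g (s.next a N) = disc g s + ∑ v ∈ N, g v := by
  have : (s.U \ N)ᶜ = s.Uᶜ ∪ N := by
    ext v; have := @hN v; simp only [Finset.mem_compl, Finset.mem_sdiff, Finset.mem_union]; tauto
  simp only [disc, State.next]
  rw [this, Finset.sum_union]
  · ring
  · exact disjoint_compl_left.mono_right hN

lemma time_addRoot {s : State n} (hA : s.A = ∅) {r : Fin n} (hr : r ∈ s.U) :
    S.time (s.addRoot r) = S.time s := by
  have : (s.addRoot r).A ∪ (s.addRoot r).U = s.A ∪ s.U := by
    rw [hA, Finset.empty_union, State.addRoot, ← Finset.insert_eq, Finset.insert_erase hr]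
  rw [time, time, this]

lemma disc_addRoot (g : Fin n → ℝ) {s : State n} (hs : Disjoint s.R s.U) {r : Fin n}
    (hr : r ∈ s.U) : disc g (s.addRoot r) = disc g s := by
  have h1 : (s.U.erase r)ᶜ = insert r s.Uᶜ := by
    ext v; simp only [Finset.mem_compl, Finset.mem_erase, Finset.mem_insert]; tauto
  have h2 : r ∉ s.R := fun h => Finset.disjoint_left.1 hs h hr
  simp only [disc, State.addRoot]
  rw [h1, Finset.sum_insert (by simpa using hr), Finset.sum_insert h2]
  ring

/-- `disc` leaves out the roots for this reason: activating a root changes no deviation, so the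
supermartingales do not notice it. -/
lemma dev_addRoot {s : State n} (hA : s.A = ∅) (hs : Disjoint s.R s.U) {r : Fin n}
    (hr : r ∈ s.U) (i : Fin 6) : S.dev (s.addRoot r) i = S.dev s i := by
  fin_cases i <;> simp only [dev, disc_addRoot _ hs hr, time_addRoot hA hr]

/-! ### Consequences of the control -/

namespace Good
variable {s : State n} (hs : S.Good s) (h : S.Valid)
include hs h

lemma dev_lt_fst {i : Fin 6} (hi : S.rate i = 1 / (S.δ * S.lam ^ 2)) :
    S.dev s i < S.δ * (S.u * S.ell) := by
  have h1 := hs.ctrl i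
  have h2 := h.lam_pos; have h3 := h.δ_pos
  rw [expo, hi, sub_lt_zero, one_div, inv_mul_lt_iff₀ (by positivity)] at h1
  rw [h.u_mul_ell]; linarith

lemma dev_lt_snd {i : Fin 6} (hi : S.rate i = 1 / (S.δ * S.f * S.lam)) :
    S.dev s i < S.δ * (S.u * (S.u * S.ell)) := by
  have h1 := hs.ctrl i
  have h2 := h.lam_pos; have h3 := h.δ_pos; have h4 := h.f_pos
  rw [expo, hi, sub_lt_zero, one_div, inv_mul_lt_iff₀ (by positivity)] at h1
  rw [h.u_mul_ell]
  have : S.u * (S.f * S.lam ^ 2) = S.f * S.lam * S.f := by rw [← h.u_mul_lam]; ring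
  rw [this]; linarith

lemma disc_sq_lt : disc (fun v => S.w v ^ 2) s
    < (S.C + S.δ) * S.time s + S.δ * (S.u * S.ell) := by
  have := hs.dev_lt_fst h (i := 0) rfl
  simp only [dev] at this; linarith

lemma lt_disc_sq : (S.C - S.δ) * S.time s - S.δ * (S.u * S.ell)
    < disc (fun v => S.w v ^ 2) s := by
  have := hs.dev_lt_fst h (i := 1) rfl
  simp only [dev] at this; linarith

lemma disc_one_lt : disc (fun _ => 1) s < (1 + S.δ) * S.time s + S.δ * (S.u * S.ell) := by
  have := hs.dev_lt_fst h (i := 2) rfl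
  simp only [dev] at this; linarith

lemma lt_disc_one : (1 - S.δ) * S.time s - S.δ * (S.u * S.ell) < disc (fun _ => 1) s := by
  have := hs.dev_lt_fst h (i := 3) rfl
  simp only [dev] at this; linarith

lemma walk_lt : ∑ v ∈ s.A, S.w v - ∑ v ∈ s.R, S.w v < S.u * S.time s * (1 - S.time s / S.x)
    + S.η₁ * S.u * S.time s + S.δ * (S.u * (S.u * S.ell)) := by
  have := hs.dev_lt_snd h (i := 4) rfl
  simp only [dev, disc_weight hs.disjoint_AU, h.path_eq] at this; linarith

lemma lt_walk : S.u * S.time s * (1 - S.time s / S.x) - S.η₁ * S.u * S.time s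
    - S.δ * (S.u * (S.u * S.ell)) < ∑ v ∈ s.A, S.w v - ∑ v ∈ s.R, S.w v := by
  have := hs.dev_lt_snd h (i := 5) rfl
  simp only [dev, disc_weight hs.disjoint_AU, h.path_eq] at this; linarith

/-- Active weight is nonnegative, so the walk stays above minus the root weight, hence above `-η u
x`. Beyond `x` the parabola is negative and passes below this level, errors included, before `(1 +
3η) x`. -/
lemma time_le : S.time s ≤ (1 + 3 * S.η) * S.x := by
  have h1 := hs.walk_lt h
  have h2 := hs.root_weight
  have h3 := h.sum_weight_nonneg s.A
  have hx := h.x_pos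
  have hu := h.u_pos
  set y := S.time s / S.x with hy
  have hty : S.time s = y * S.x := by rw [hy]; field_simp
  have hCx := h.C_mul_x
  have h4 := h.four_η₁
  have h5 : S.δ * (S.u * (S.u * S.ell)) = S.u * S.x * (S.δ * S.C / 2) := by
    linear_combination (-S.δ * S.u / 2) * hCx
  rw [hty, h5] at h1
  have h6 : 0 < S.u * S.x * (y * (1 - y) + S.η₁ * y + S.δ * S.C / 2 + S.η) := by
    nlinarith
  have h7 : 0 < y * (1 - y) + S.η₁ * y + S.δ * S.C / 2 + S.η :=
    pos_of_mul_pos_right h6 (mul_pos hu hx).le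
  rw [hty]
  refine mul_le_mul_of_nonneg_right ?_ hx.le
  have h8 := h.δ_pos; have h9 := h.C_pos; have h10 := h.η_pos; have h11 := h.η₁_pos
  have h12 := mul_pos h8 h9
  by_contra hcon
  push Not at hcon
  nlinarith [mul_pos (sub_pos.2 hcon) h10]

lemma time_le_two : S.time s ≤ 2 * S.x := by
  have := hs.time_le h; have := h.η_le; have := h.x_pos
  nlinarith

lemma walk_err : S.η₁ * S.u * S.time s + S.δ * (S.u * (S.u * S.ell)) ≤ S.η * S.u * S.x := by
  have h1 := hs.time_le_two h
  have h4 := h.four_η₁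
  have hCx := h.C_mul_x
  have hux := mul_pos h.u_pos h.x_pos
  have h5 : S.δ * (S.u * (S.u * S.ell)) = S.u * S.x * (S.δ * S.C / 2) := by
    linear_combination (-S.δ * S.u / 2) * hCx
  rw [h5]
  have h6 : S.η₁ * S.u * S.time s ≤ S.η₁ * S.u * (2 * S.x) :=
    mul_le_mul_of_nonneg_left h1 (mul_pos h.η₁_pos h.u_pos).le
  have h7 : 0 ≤ S.u * S.x * (2 * S.η - (4 * S.η₁ + 2 * S.δ * S.C)) :=
    mul_nonneg hux.le (by linarith)
  have h8 := mul_pos hux (mul_pos h.δ_pos h.C_pos)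
  nlinarith

lemma sum_compl_le : ∑ v ∈ s.Uᶜ, S.w v ≤ 3 * S.x := by
  rw [sum_compl_U hs.disjoint_AU]
  have h1 := hs.walk_lt h
  have h2 := hs.root_weight
  have h3 := hs.walk_err h
  have h4 := hs.time_le_two h
  have h5 := h.u_le; have h6 := h.κ_le; have hx := h.x_pos; have hu := h.u_pos
  have h7 := h.η_le
  have ht := h.time_nonneg s
  have h8 : S.u * S.time s * (1 - S.time s / S.x) ≤ S.u * S.time s := by
    have : 0 ≤ S.time s / S.x := by positivity
    nlinarith [mul_nonneg hu.le ht]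
  have h9 : S.u * S.time s ≤ 1 / 4 * (2 * S.x) :=
    mul_le_mul (h5.trans h6) h4 ht (by norm_num)
  have h10 : S.η * S.u * S.x ≤ 1 / 100 * (1 / 4) * S.x := by
    refine mul_le_mul_of_nonneg_right ?_ hx.le
    exact mul_le_mul h7 (h5.trans h6) hu.le (by norm_num)
  change S.time s + _ ≤ _
  linarith

lemma roots_sq_le : ∑ v ∈ s.R, S.w v ^ 2 ≤ S.δ * (S.u * S.ell) := by
  have h1 : ∑ v ∈ s.R, S.w v ^ 2 ≤ S.c₂ * ∑ v ∈ s.R, S.w v := by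
    rw [Finset.mul_sum]
    refine Finset.sum_le_sum fun v hv => ?_
    rw [sq]
    exact mul_le_mul_of_nonneg_right (hs.root_mid v hv).2 (h.w_nonneg v)
  have h2 := mul_le_mul_of_nonneg_left hs.root_weight h.c₂_pos.le
  have hue := mul_pos h.u_pos h.ell_pos
  have h3 : S.c₂ * (S.η * S.u * S.x) = (2 * S.c₂ * S.u / S.C) * (S.η * (S.u * S.ell)) := by
    rw [x]; field_simp
  have h4 : 2 * S.c₂ * S.u / S.C ≤ S.δ := by
    refine le_trans ?_ h.κ_c₂'
    have := h.c₂_pos; have := h.C_pos; have := h.u_le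
    gcongr
  have h5 : (2 * S.c₂ * S.u / S.C) * (S.η * (S.u * S.ell)) ≤ S.δ * (S.η * (S.u * S.ell)) :=
    mul_le_mul_of_nonneg_right h4 (mul_pos h.η_pos hue).le
  have h6 : S.δ * (S.η * (S.u * S.ell)) ≤ S.δ * (1 * (S.u * S.ell)) := by
    refine mul_le_mul_of_nonneg_left (mul_le_mul_of_nonneg_right ?_ hue.le) h.δ_pos.le
    linarith [h.η_le]
  linarith

/-- Roots weigh at least `c₁ ≥ κ ≥ u`, so the weight budget `η u x` allows at most `η x` of them.
The upper bound `c₂` on their weights plays the same part for the sum of squares. -/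
lemma card_roots_le : (s.R.card : ℝ) ≤ S.η * S.x := by
  have h1 : S.c₁ * s.R.card ≤ ∑ v ∈ s.R, S.w v := by
    rw [mul_comm, ← nsmul_eq_mul]
    exact Finset.card_nsmul_le_sum _ _ _ fun v hv => (hs.root_mid v hv).1
  have h2 := hs.root_weight
  have h3 : S.η * S.u * S.x ≤ S.c₁ * (S.η * S.x) := by
    have := mul_le_mul_of_nonneg_right (h.u_le.trans h.κ_c₁) (mul_pos h.η_pos h.x_pos).le
    linarith
  exact le_of_mul_le_mul_left (h1.trans (h2.trans h3)) h.c₁_pos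

lemma lt_sum_sq_compl : (S.C - S.δ) * S.time s - S.δ * (S.u * S.ell)
    < ∑ v ∈ s.Uᶜ, S.w v ^ 2 := by
  have heq : ∑ v ∈ s.Uᶜ, S.w v ^ 2 = disc (fun v => S.w v ^ 2) s + ∑ v ∈ s.R, S.w v ^ 2 := by
    rw [disc]; ring
  rw [heq]
  have := hs.lt_disc_sq h
  have : 0 ≤ ∑ v ∈ s.R, S.w v ^ 2 := Finset.sum_nonneg fun _ _ => sq_nonneg _
  linarith

lemma sum_sq_compl_lt : ∑ v ∈ s.Uᶜ, S.w v ^ 2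
    < (S.C + S.δ) * S.time s + 2 * S.δ * (S.u * S.ell) := by
  have heq : ∑ v ∈ s.Uᶜ, S.w v ^ 2 = disc (fun v => S.w v ^ 2) s + ∑ v ∈ s.R, S.w v ^ 2 := by
    rw [disc]; ring
  rw [heq]
  linarith [hs.disc_sq_lt h, hs.roots_sq_le h]

lemma δ_time_le : S.δ * S.time s ≤ S.δ * (4 / S.C) * (S.u * S.ell) := by
  have h1 := mul_le_mul_of_nonneg_left (hs.time_le_two h) h.δ_pos.le
  have : S.δ * (2 * S.x) = S.δ * (4 / S.C) * (S.u * S.ell) := by rw [x]; ring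
  linarith

lemma sum_sq_compl_le : ∑ v ∈ s.Uᶜ, S.w v ^ 2 ≤ 7 * (S.u * S.ell) := by
  have h1 := hs.sum_sq_compl_lt h
  have h2 := hs.time_le_two h
  have hCx := h.C_mul_x
  have h3 := h.δ_le_C; have h4 := h.δ_le_one; have h5 := mul_pos h.u_pos h.ell_pos
  have h6 := h.C_pos; have h7 := h.x_pos; have h8 := h.δ_pos
  have h9 : (S.C + S.δ) * S.time s ≤ (S.C + S.C / 4) * (2 * S.x) :=
    mul_le_mul (by linarith) h2 (h.time_nonneg s) (by linarith)
  nlinarith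

lemma card_compl_le : ((s.Uᶜ).card : ℝ) ≤ S.time s + 2 * (S.η * S.x) := by
  have h1 := hs.disc_one_lt h
  have h2 := hs.card_roots_le h
  have h3 := hs.time_le_two h
  have hCx := h.C_mul_x
  have h4 := mul_le_mul_of_nonneg_right h.δ_η h.x_pos.le
  have h5 := mul_le_mul_of_nonneg_left h3 h.δ_pos.le
  simp only [disc, Finset.sum_const, nsmul_eq_mul, mul_one] at h1
  have h6 : S.δ * (S.u * S.ell) = S.δ * S.C / 2 * S.x := by linear_combination (-S.δ / 2) * hCx
  linarith

lemma le_card_compl : S.time s - S.η * S.x ≤ ((s.Uᶜ).card : ℝ) := by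
  have h1 := hs.lt_disc_one h
  have h3 := hs.time_le_two h
  have hCx := h.C_mul_x
  have h4 := mul_le_mul_of_nonneg_right h.δ_η h.x_pos.le
  have h5 := mul_le_mul_of_nonneg_left h3 h.δ_pos.le
  simp only [disc, Finset.sum_const, nsmul_eq_mul, mul_one] at h1
  have h6 : S.δ * (S.u * S.ell) = S.δ * S.C / 2 * S.x := by linear_combination (-S.δ / 2) * hCx
  have : (0 : ℝ) ≤ s.R.card := Nat.cast_nonneg _
  linarith

end Good
/-! ### The supermartingales of the exploration -/

namespace Valid
variable (h : S.Valid)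
include h

lemma sum_three_le (U : Finset (Fin n)) : ∑ v ∈ U, S.w v ^ 3 ≤ (S.C + S.κ) * S.ell := by
  have h1 := (abs_le.1 h.sum_three).2
  have h2 : ∑ v ∈ U, S.w v ^ 3 ≤ ∑ v, S.w v ^ 3 :=
    Finset.sum_le_sum_of_subset_of_nonneg (Finset.subset_univ _)
      fun i _ _ => pow_nonneg (h.w_nonneg i) 3
  unfold ell; linarith

lemma sum_two_le : ∑ v, S.w v ^ 2 ≤ S.ell + S.κ * (S.u * S.ell) := by
  have h1 := (abs_le.1 h.sum_two).2
  have h2 := mul_le_mul_of_nonneg_left h.lam_sq_le h.κ_pos.le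
  change _ ≤ S.lam ^ 3 + _; linarith

lemma le_sum_two : S.ell - S.κ * (S.u * S.ell) ≤ ∑ v, S.w v ^ 2 := by
  have h1 := (abs_le.1 h.sum_two).1
  have h2 := mul_le_mul_of_nonneg_left h.lam_sq_le h.κ_pos.le
  change S.lam ^ 3 - _ ≤ _; linarith

lemma p_le : S.p ≤ 2 / S.ell := by
  rw [h.p_eq]
  exact div_le_div_of_nonneg_right (by linarith [h.u_le, h.κ_le]) h.ell_pos.le

lemma p_mul_le_iff {X c : ℝ} : S.p * X ≤ c ↔ (1 + S.u) * X ≤ c * S.ell := by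
  rw [h.p_eq, div_mul_eq_mul_div, div_le_iff₀ h.ell_pos]

lemma le_p_mul_iff {X c : ℝ} : c ≤ S.p * X ↔ c * S.ell ≤ (1 + S.u) * X := by
  rw [h.p_eq, div_mul_eq_mul_div, le_div_iff₀ h.ell_pos]

lemma p_mul_w_le (a : Fin n) : S.p * S.w a ≤ 2 * S.κ / S.lam ^ 2 := by
  calc S.p * S.w a ≤ 2 / S.ell * (S.κ * S.lam) :=
        mul_le_mul h.p_le (h.w_le a) (h.w_nonneg a) (div_pos two_pos h.ell_pos).le
    _ = _ := by
      have := h.lam_pos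
      rw [ell]; field_simp

lemma rate_fst_pos : 0 < 1 / (S.δ * S.lam ^ 2) := by
  have := h.δ_pos; have := h.lam_pos; positivity

lemma rate_snd_pos : 0 < 1 / (S.δ * S.f * S.lam) := by
  have := h.δ_pos; have := h.lam_pos; have := h.f_pos; positivity

lemma w_sq_le (v : Fin n) : S.w v ^ 2 ≤ S.κ ^ 2 * S.lam ^ 2 := by
  rw [← mul_pow]; exact pow_le_pow_left₀ (h.w_nonneg v) (h.w_le v) 2

lemma rate_fst_mul_sq : 1 / (S.δ * S.lam ^ 2) * (S.κ ^ 2 * S.lam ^ 2) = S.κ ^ 2 / S.δ := by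
  have := h.δ_pos; have := h.lam_pos; field_simp

lemma rate_fst_le : 1 / (S.δ * S.lam ^ 2) ≤ S.κ ^ 2 / S.δ := by
  rw [← h.rate_fst_mul_sq]
  have h1 := h.one_le_κ_lam
  have : 1 ≤ S.κ ^ 2 * S.lam ^ 2 := by rw [← mul_pow]; exact one_le_pow₀ h1
  exact le_mul_of_one_le_right h.rate_fst_pos.le this

lemma κ_sq_div_le_one : S.κ ^ 2 / S.δ ≤ 1 := by
  rw [div_le_one h.δ_pos]
  nlinarith [h.κ_δ, h.κ_le, h.κ_pos]

lemma rate_snd_mul_w_le (v : Fin n) : 1 / (S.δ * S.f * S.lam) * S.w v ≤ 1 := by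
  have h1 := h.δ_pos; have h2 := h.lam_pos; have h3 := h.f_pos
  rw [one_div, inv_mul_le_iff₀ (by positivity), mul_one]
  refine (h.w_le v).trans (mul_le_mul_of_nonneg_right ?_ h2.le)
  nlinarith [h.κ_δ, h.κ_pos, h.one_le_f]

lemma rate_snd_le : 1 / (S.δ * S.f * S.lam) * (2 * (S.C + 1)) ≤ S.δ * S.u := by
  have h1 := h.δ_pos; have h2 := h.lam_pos; have h3 := h.f_pos
  rw [one_div, inv_mul_le_iff₀ (by positivity)]
  have : S.δ * S.f * S.lam * (S.δ * S.u) = S.δ ^ 2 * S.f ^ 2 := by rw [← h.u_mul_lam]; ring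
  rw [this]; exact h.f_sq

lemma sum_five_le (U : Finset (Fin n)) :
    ∑ v ∈ U, S.w v * (S.w v ^ 2) ^ 2 ≤ S.κ ^ 2 * S.lam ^ 2 * ((S.C + S.κ) * S.ell) := by
  have hκ := h.κ_pos; have hl := h.lam_pos
  refine le_trans ?_ (mul_le_mul_of_nonneg_left (h.sum_three_le U) (by positivity))
  rw [Finset.mul_sum]
  refine Finset.sum_le_sum fun v _ => ?_
  have := mul_le_mul_of_nonneg_right (h.w_sq_le v) (pow_nonneg (h.w_nonneg v) 3)
  linarith

lemma sum_four_le (U : Finset (Fin n)) :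
    ∑ v ∈ U, S.w v ^ 2 * S.w v ^ 2 ≤ S.κ * S.lam * ((S.C + S.κ) * S.ell) := by
  have hκ := h.κ_pos; have hl := h.lam_pos
  refine le_trans ?_ (mul_le_mul_of_nonneg_left (h.sum_three_le U) (by positivity))
  rw [Finset.mul_sum]
  refine Finset.sum_le_sum fun v _ => ?_
  have := mul_le_mul_of_nonneg_right (h.w_le v) (pow_nonneg (h.w_nonneg v) 3)
  linarith

/-- Large weights do not contribute much to the third moment of a set with small second moment. -/
lemma sum_three_small (X : Finset (Fin n)) :
    ∑ v ∈ X, S.w v ^ 3 ≤ S.K * ∑ v ∈ X, S.w v ^ 2 + S.δ / 4 * S.ell := by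
  have h1 : ∑ v ∈ X, S.w v ^ 3 = ∑ v ∈ X with S.K < S.w v, S.w v ^ 3
      + ∑ v ∈ X with ¬ S.K < S.w v, S.w v ^ 3 := (Finset.sum_filter_add_sum_filter_not _ _ _).symm
  have h2 : ∑ v ∈ X with S.K < S.w v, S.w v ^ 3 ≤ S.δ / 4 * S.ell := by
    refine le_trans ?_ h.tail
    exact Finset.sum_le_sum_of_subset_of_nonneg
      (Finset.filter_subset_filter _ (Finset.subset_univ _))
      fun i _ _ => pow_nonneg (h.w_nonneg i) 3
  have h3 : ∑ v ∈ X with ¬ S.K < S.w v, S.w v ^ 3 ≤ S.K * ∑ v ∈ X, S.w v ^ 2 := by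
    rw [Finset.mul_sum]
    refine le_trans (Finset.sum_le_sum fun v hv => ?_) (Finset.sum_le_sum_of_subset_of_nonneg
      (Finset.filter_subset _ _) fun i _ _ => mul_nonneg h.K_pos.le (sq_nonneg _))
    have := mul_le_mul_of_nonneg_right (not_lt.1 (Finset.mem_filter.1 hv).2) (sq_nonneg (S.w v))
    linarith
  linarith

end Valid

lemma sum_add_sum_compl' (U : Finset (Fin n)) (g : Fin n → ℝ) :
    ∑ v ∈ U, g v = ∑ v, g v - ∑ v ∈ Uᶜ, g v := by
  rw [← Finset.sum_add_sum_compl U g]; ring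

lemma η₁_eq : S.η₁ = S.δ * (4 / S.C) + 6 * S.δ := by unfold η₁; ring

section Step
variable {s : State n} (hs : S.Good s) (h : S.Valid) {a : Fin n} (ha : a ∈ s.A)
include hs h ha

/-- Revealing `a` advances the clock by `w a` and adds the `g` of its new neighbours. If the
compensator `φ` grows by at least `c w a`, with `c` dominating the exponential drift, the
compensated exponential cannot increase in mean. -/
lemma integral_exp_disc_le {g : Fin n → ℝ} (hg : ∀ u, 0 ≤ g u) {θ : ℝ} (hθ : 0 ≤ θ)
    (hθg : ∀ u, θ * g u ≤ 1) {c : ℝ} (φ : ℝ → ℝ)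
    (hφ : c * S.w a ≤ φ (S.time s + S.w a) - φ (S.time s))
    (hc : S.p * (∑ u ∈ s.U, S.w u * g u + θ * ∑ u ∈ s.U, S.w u * g u ^ 2) ≤ c) :
    ∫ ω, Real.exp (θ * (disc g (s.next a (nbrs ω a s.U))
      - φ (S.time (s.next a (nbrs ω a s.U)))) - S.f) ∂(edgeLaw S.w S.p)
      ≤ Real.exp (θ * (disc g s - φ (S.time s)) - S.f) := by
  have haU : a ∉ s.U := Finset.disjoint_left.1 hs.disjoint_AU ha
  have key := integral_exp_nbrs_le_one h.w_nonneg h.p_pos.le haU hg hθ hθg hc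
  calc _ ≤ ∫ ω, Real.exp (θ * (disc g s - φ (S.time s)) - S.f)
        * Real.exp (θ * (∑ u ∈ nbrs ω a s.U, g u - c * S.w a)) ∂(edgeLaw S.w S.p) := by
        refine integral_mono (integrable_edgeLaw _ _ _) (integrable_edgeLaw _ _ _) fun ω => ?_
        dsimp only
        rw [disc_next g (nbrs_subset _ _ _), time_next hs.disjoint_AU ha (nbrs_subset _ _ _),
          ← Real.exp_add]
        refine Real.exp_le_exp.2 ?_
        linarith [mul_le_mul_of_nonneg_left hφ hθ]
    _ ≤ _ := by
        rw [integral_const_mul]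
        exact mul_le_of_le_one_right (Real.exp_pos _).le key

lemma integral_exp_neg_disc_le {g : Fin n → ℝ} (hg : ∀ u, 0 ≤ g u) {θ : ℝ} (hθ : 0 ≤ θ)
    {c : ℝ} (φ : ℝ → ℝ)
    (hφ : φ (S.time s + S.w a) - φ (S.time s) ≤ c * S.w a)
    (hc : c ≤ S.p * (∑ u ∈ s.U, S.w u * g u - S.p * S.w a * ∑ u ∈ s.U, S.w u ^ 2 * g u
      - θ * ∑ u ∈ s.U, S.w u * g u ^ 2)) :
    ∫ ω, Real.exp (θ * (-(disc g (s.next a (nbrs ω a s.U))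
      - φ (S.time (s.next a (nbrs ω a s.U))))) - S.f) ∂(edgeLaw S.w S.p)
      ≤ Real.exp (θ * (-(disc g s - φ (S.time s))) - S.f) := by
  have haU : a ∉ s.U := Finset.disjoint_left.1 hs.disjoint_AU ha
  have key := integral_exp_neg_nbrs_le_one h.w_nonneg h.p_pos.le haU hg hθ hc
  calc _ ≤ ∫ ω, Real.exp (θ * (-(disc g s - φ (S.time s))) - S.f)
        * Real.exp (-(θ * (∑ u ∈ nbrs ω a s.U, g u - c * S.w a))) ∂(edgeLaw S.w S.p) := by
        refine integral_mono (integrable_edgeLaw _ _ _) (integrable_edgeLaw _ _ _) fun ω => ?_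
        dsimp only
        rw [disc_next g (nbrs_subset _ _ _), time_next hs.disjoint_AU ha (nbrs_subset _ _ _),
          ← Real.exp_add]
        refine Real.exp_le_exp.2 ?_
        linarith [mul_le_mul_of_nonneg_left hφ hθ]
    _ ≤ _ := by
        rw [integral_const_mul]
        exact mul_le_of_le_one_right (Real.exp_pos _).le key

omit hs ha in
lemma slope_sq_le : S.p * (∑ u ∈ s.U, S.w u * S.w u ^ 2
    + 1 / (S.δ * S.lam ^ 2) * ∑ u ∈ s.U, S.w u * (S.w u ^ 2) ^ 2) ≤ S.C + S.δ := by
  have h1 := h.sum_three_le s.U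
  have h2 := mul_le_mul_of_nonneg_left (h.sum_five_le s.U) h.rate_fst_pos.le
  rw [← mul_assoc, h.rate_fst_mul_sq] at h2
  have h3 : ∑ u ∈ s.U, S.w u * S.w u ^ 2 = ∑ u ∈ s.U, S.w u ^ 3 :=
    Finset.sum_congr rfl fun u _ => by ring
  rw [h.p_mul_le_iff, h3]
  have h4 := h.C_pos; have h5 := h.κ_pos; have h6 := h.ell_pos; have h7 := h.δ_pos
  have h8 := h.u_pos
  have h9 : 0 ≤ (S.C + S.κ) * S.ell + S.κ ^ 2 / S.δ * ((S.C + S.κ) * S.ell) := by positivity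
  calc _ ≤ (1 + S.u) * ((S.C + S.κ) * S.ell + S.κ ^ 2 / S.δ * ((S.C + S.κ) * S.ell)) :=
        mul_le_mul_of_nonneg_left (add_le_add h1 h2) (by linarith)
    _ ≤ (1 + S.κ) * ((S.C + S.κ) * S.ell + S.κ ^ 2 / S.δ * ((S.C + S.κ) * S.ell)) :=
        mul_le_mul_of_nonneg_right (by linarith [h.u_le]) h9
    _ = (1 + S.κ) * (S.C + S.κ) * (1 + S.κ ^ 2 / S.δ) * S.ell := by ring
    _ ≤ _ := mul_le_mul_of_nonneg_right h.κ_up₂ h6.le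

omit ha in
-- The discovered vertices must not remove much third moment from `U`. Their second moment is at
-- most `7uℓ` by the control, and `sum_three_small` converts this through the truncation at `K`.
lemma le_slope_sq : S.C - S.δ ≤ S.p * (∑ u ∈ s.U, S.w u * S.w u ^ 2
    - S.p * S.w a * ∑ u ∈ s.U, S.w u ^ 2 * S.w u ^ 2
    - 1 / (S.δ * S.lam ^ 2) * ∑ u ∈ s.U, S.w u * (S.w u ^ 2) ^ 2) := by
  have h2 := mul_le_mul_of_nonneg_left (h.sum_five_le s.U) h.rate_fst_pos.le
  rw [← mul_assoc, h.rate_fst_mul_sq] at h2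
  have h4 := h.C_pos; have h5 := h.κ_pos; have h6 := h.ell_pos; have h7 := h.δ_pos
  have h8 := h.u_pos; have hl := h.lam_pos
  have h3 : ∑ u ∈ s.U, S.w u * S.w u ^ 2 = ∑ u ∈ s.U, S.w u ^ 3 :=
    Finset.sum_congr rfl fun u _ => by ring
  have h9 : S.p * S.w a * ∑ u ∈ s.U, S.w u ^ 2 * S.w u ^ 2
      ≤ 2 * S.κ ^ 2 * ((S.C + S.κ) * S.ell) := by
    calc _ ≤ 2 * S.κ / S.lam ^ 2 * (S.κ * S.lam * ((S.C + S.κ) * S.ell)) :=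
          mul_le_mul (h.p_mul_w_le a) (h.sum_four_le s.U)
            (Finset.sum_nonneg fun _ _ => by positivity) (by positivity)
      _ = 2 * S.κ ^ 2 * ((S.C + S.κ) * S.ell) / S.lam := by field_simp
      _ ≤ _ := div_le_self (by positivity) h.one_le_lam
  have h10 := (abs_le.1 h.sum_three).1
  have h11 := h.sum_three_small s.Uᶜ
  have h12 := mul_le_mul_of_nonneg_left (hs.sum_sq_compl_le h) h.K_pos.le
  have h13 : S.K * (7 * (S.u * S.ell)) ≤ 7 * S.K * S.κ * S.ell := by
    have := mul_le_mul_of_nonneg_right h.u_le (mul_pos h.K_pos h6).le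
    linarith
  have h14 := mul_le_mul_of_nonneg_right h.κ_low₂ h6.le
  rw [h3, sum_add_sum_compl' s.U (fun v => S.w v ^ 3)]
  set I := ∑ v, S.w v ^ 3 - ∑ v ∈ s.Uᶜ, S.w v ^ 3
    - S.p * S.w a * ∑ u ∈ s.U, S.w u ^ 2 * S.w u ^ 2
    - 1 / (S.δ * S.lam ^ 2) * ∑ u ∈ s.U, S.w u * (S.w u ^ 2) ^ 2 with hI
  have h15 : (S.C - S.δ) * S.ell ≤ I := by
    change -(S.κ * S.ell) ≤ _ - S.C * S.ell at h10
    linarith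
  rw [h.le_p_mul_iff]
  have h16 : 0 ≤ (S.C - S.δ) * S.ell := mul_nonneg (by linarith [h.δ_le_C]) h6.le
  nlinarith

omit ha hs in
lemma slope_one_le : S.p * (∑ u ∈ s.U, S.w u * 1
    + 1 / (S.δ * S.lam ^ 2) * ∑ u ∈ s.U, S.w u * 1 ^ 2) ≤ 1 + S.δ := by
  have h1 : ∑ u ∈ s.U, S.w u ≤ S.ell := by
    rw [ell, ← h.sum_one]
    exact Finset.sum_le_sum_of_subset_of_nonneg (Finset.subset_univ _) fun i _ _ => h.w_nonneg i
  have h0 := h.sum_weight_nonneg s.U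
  have h2 := mul_le_mul h.rate_fst_le h1 h0 (div_nonneg (sq_nonneg _) h.δ_pos.le)
  have h5 := h.κ_pos; have h6 := h.ell_pos; have h7 := h.δ_pos; have h8 := h.u_pos
  simp only [one_pow, mul_one]
  rw [h.p_mul_le_iff]
  have h9 : 0 ≤ S.ell + S.κ ^ 2 / S.δ * S.ell := by positivity
  calc _ ≤ (1 + S.u) * (S.ell + S.κ ^ 2 / S.δ * S.ell) :=
        mul_le_mul_of_nonneg_left (add_le_add h1 h2) (by linarith)
    _ ≤ (1 + S.κ) * (S.ell + S.κ ^ 2 / S.δ * S.ell) :=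
        mul_le_mul_of_nonneg_right (by linarith [h.u_le]) h9
    _ = (1 + S.κ) * (1 + S.κ ^ 2 / S.δ) * S.ell := by ring
    _ ≤ _ := mul_le_mul_of_nonneg_right h.κ_up₀ h6.le

omit ha in
lemma le_slope_one : 1 - S.δ ≤ S.p * (∑ u ∈ s.U, S.w u * 1
    - S.p * S.w a * ∑ u ∈ s.U, S.w u ^ 2 * 1
    - 1 / (S.δ * S.lam ^ 2) * ∑ u ∈ s.U, S.w u * 1 ^ 2) := by
  have h5 := h.κ_pos; have h6 := h.ell_pos; have h7 := h.δ_pos; have h8 := h.u_pos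
  have hl := h.lam_pos; have hC := h.C_pos
  have h1 : ∑ u ∈ s.U, S.w u ≤ S.ell := by
    rw [ell, ← h.sum_one]
    exact Finset.sum_le_sum_of_subset_of_nonneg (Finset.subset_univ _) fun i _ _ => h.w_nonneg i
  have h2 := mul_le_mul h.rate_fst_le h1 (h.sum_weight_nonneg s.U)
    (div_nonneg (sq_nonneg _) h.δ_pos.le)
  have h3 := hs.sum_compl_le h
  have h4 : 3 * S.x ≤ 6 * S.κ / S.C * S.ell := by
    have : 3 * S.x = 6 * S.u / S.C * S.ell := by rw [x]; ring
    rw [this]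
    have := h.u_le
    gcongr
  have h9 : S.p * S.w a * ∑ u ∈ s.U, S.w u ^ 2 ≤ 4 * S.κ * S.ell := by
    have h10 : ∑ u ∈ s.U, S.w u ^ 2 ≤ 2 * S.ell := by
      have h11 : ∑ u ∈ s.U, S.w u ^ 2 ≤ ∑ u, S.w u ^ 2 :=
        Finset.sum_le_sum_of_subset_of_nonneg (Finset.subset_univ _) fun i _ _ => sq_nonneg _
      have h12 : S.κ * (S.u * S.ell) ≤ 1 * (1 * S.ell) := by
        have := h.κ_le; have := h.u_le
        gcongr <;> linarith
      linarith [h.sum_two_le]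
    have h13 : S.p * S.w a ≤ 2 * S.κ :=
      (h.p_mul_w_le a).trans (div_le_self (by positivity) (one_le_pow₀ h.one_le_lam))
    have := mul_le_mul h13 h10 (Finset.sum_nonneg fun _ _ => sq_nonneg _) (by positivity)
    linarith
  simp only [one_pow, mul_one]
  have h14 := mul_le_mul_of_nonneg_right h.κ_low₀ h6.le
  have h15 := sum_add_sum_compl' s.U S.w
  rw [h.sum_one] at h15
  change _ = S.ell - _ at h15
  rw [h.le_p_mul_iff]
  set I := ∑ u ∈ s.U, S.w u - S.p * S.w a * ∑ u ∈ s.U, S.w u ^ 2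
    - 1 / (S.δ * S.lam ^ 2) * ∑ u ∈ s.U, S.w u
  have h16 : (1 - S.δ) * S.ell ≤ I := by linarith
  have h17 : 0 ≤ (1 - S.δ) * S.ell := mul_nonneg (by linarith [h.δ_le_one]) h6.le
  nlinarith

omit ha in
-- Control of the discovered `w²` makes `p ∑_U w²` fall linearly in time, with errors of order `δ u`
-- collected in `η₁ u`. The last term on the right makes the bound the exact increment of the
-- parabola over a clock step `w a`, divided by `w a`; in the lower bound that term can be dropped
-- because of its sign.
lemma slope_weight_le : S.p * (∑ u ∈ s.U, S.w u * S.w u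
    + 1 / (S.δ * S.f * S.lam) * ∑ u ∈ s.U, S.w u * S.w u ^ 2)
    ≤ 1 + S.u + S.η₁ * S.u - S.C * S.time s / S.ell - S.C * S.w a / (2 * S.ell) := by
  have h5 := h.κ_pos; have h6 := h.ell_pos; have h7 := h.δ_pos; have h8 := h.u_pos
  have hl := h.lam_pos; have hC := h.C_pos; have hul := mul_pos h8 h6
  have e1 : ∑ u ∈ s.U, S.w u * S.w u = ∑ u ∈ s.U, S.w u ^ 2 :=
    Finset.sum_congr rfl fun u _ => by ring
  have e2 : ∑ u ∈ s.U, S.w u * S.w u ^ 2 = ∑ u ∈ s.U, S.w u ^ 3 :=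
    Finset.sum_congr rfl fun u _ => by ring
  rw [e1, e2, sum_add_sum_compl' s.U (fun v => S.w v ^ 2), h.p_mul_le_iff]
  have h1 := h.sum_two_le
  have h2 := hs.lt_sum_sq_compl h
  have h3 : 1 / (S.δ * S.f * S.lam) * ∑ u ∈ s.U, S.w u ^ 3 ≤ S.δ * (S.u * S.ell) / 2 := by
    have h9 := mul_le_mul_of_nonneg_left (h.sum_three_le s.U) h.rate_snd_pos.le
    have h10 := mul_le_mul_of_nonneg_right h.rate_snd_le h6.le
    have h11 : 1 / (S.δ * S.f * S.lam) * ((S.C + S.κ) * S.ell)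
        ≤ 1 / (S.δ * S.f * S.lam) * ((S.C + 1) * S.ell) := by
      refine mul_le_mul_of_nonneg_left ?_ h.rate_snd_pos.le
      exact mul_le_mul_of_nonneg_right (by linarith [h.κ_le]) h6.le
    linarith
  have h4 := hs.δ_time_le h
  have hq : 0 ≤ ∑ v ∈ s.Uᶜ, S.w v ^ 2 := Finset.sum_nonneg fun _ _ => sq_nonneg _
  have hwa : S.C * S.w a / 2 ≤ S.C * S.κ * (S.u * S.ell) / 2 := by
    have := mul_le_mul_of_nonneg_left ((h.w_le a).trans
      (mul_le_mul_of_nonneg_left h.lam_le h5.le)) hC.le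
    linarith
  have e3 : (1 + S.u + S.η₁ * S.u - S.C * S.time s / S.ell - S.C * S.w a / (2 * S.ell)) * S.ell
      = S.ell + S.u * S.ell + S.η₁ * (S.u * S.ell) - S.C * S.time s - S.C * S.w a / 2 := by
    field_simp
  rw [e3, η₁_eq]
  have h12 := mul_le_mul_of_nonneg_right h.κ_up₁ hul.le
  have h13 : (1 + S.u) * (∑ v, S.w v ^ 2) ≤ S.ell + S.u * S.ell + 2 * S.κ * (S.u * S.ell) := by
    have h14 := mul_le_mul_of_nonneg_left h1 (by linarith : 0 ≤ 1 + S.u)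
    have h15 : S.u * (S.κ * (S.u * S.ell)) ≤ 1 * (S.κ * (S.u * S.ell)) :=
      mul_le_mul_of_nonneg_right (by linarith [h.u_le, h.κ_le]) (mul_pos h5 hul).le
    linarith
  have h16 : (1 + S.u) * (1 / (S.δ * S.f * S.lam) * ∑ u ∈ s.U, S.w u ^ 3)
      ≤ 2 * (S.δ * (S.u * S.ell) / 2) :=
    mul_le_mul (by linarith [h.u_le, h.κ_le]) h3 (mul_nonneg h.rate_snd_pos.le
      (Finset.sum_nonneg fun u _ => pow_nonneg (h.w_nonneg u) 3)) two_pos.le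
  have h17 : 0 ≤ S.u * ∑ v ∈ s.Uᶜ, S.w v ^ 2 := mul_nonneg h8.le hq
  have h18 := mul_pos h7 hul
  have h19 := mul_pos (mul_pos hC h5) hul
  linarith

omit ha in
lemma le_slope_weight : 1 + S.u - S.η₁ * S.u - S.C * S.time s / S.ell
    ≤ S.p * (∑ u ∈ s.U, S.w u * S.w u - S.p * S.w a * ∑ u ∈ s.U, S.w u ^ 2 * S.w u
      - 1 / (S.δ * S.f * S.lam) * ∑ u ∈ s.U, S.w u * S.w u ^ 2) := by
  have h5 := h.κ_pos; have h6 := h.ell_pos; have h7 := h.δ_pos; have h8 := h.u_pos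
  have hl := h.lam_pos; have hC := h.C_pos; have hul := mul_pos h8 h6
  have e1 : ∑ u ∈ s.U, S.w u * S.w u = ∑ u ∈ s.U, S.w u ^ 2 :=
    Finset.sum_congr rfl fun u _ => by ring
  have e2 : ∑ u ∈ s.U, S.w u * S.w u ^ 2 = ∑ u ∈ s.U, S.w u ^ 3 :=
    Finset.sum_congr rfl fun u _ => by ring
  have e2' : ∑ u ∈ s.U, S.w u ^ 2 * S.w u = ∑ u ∈ s.U, S.w u ^ 3 :=
    Finset.sum_congr rfl fun u _ => by ring
  rw [e1, e2, e2', sum_add_sum_compl' s.U (fun v => S.w v ^ 2), h.le_p_mul_iff]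
  have h1 := h.le_sum_two
  have h2 := hs.sum_sq_compl_lt h
  have hq7 := hs.sum_sq_compl_le h
  have h3n : 0 ≤ ∑ u ∈ s.U, S.w u ^ 3 := Finset.sum_nonneg fun u _ => pow_nonneg (h.w_nonneg u) 3
  have h3 : 1 / (S.δ * S.f * S.lam) * ∑ u ∈ s.U, S.w u ^ 3 ≤ S.δ * (S.u * S.ell) / 2 := by
    have h9 := mul_le_mul_of_nonneg_left (h.sum_three_le s.U) h.rate_snd_pos.le
    have h10 := mul_le_mul_of_nonneg_right h.rate_snd_le h6.le
    have h11 : 1 / (S.δ * S.f * S.lam) * ((S.C + S.κ) * S.ell)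
        ≤ 1 / (S.δ * S.f * S.lam) * ((S.C + 1) * S.ell) := by
      refine mul_le_mul_of_nonneg_left ?_ h.rate_snd_pos.le
      exact mul_le_mul_of_nonneg_right (by linarith [h.κ_le]) h6.le
    linarith
  have h4 := hs.δ_time_le h
  have hp3 : S.p * S.w a * ∑ u ∈ s.U, S.w u ^ 3 ≤ 2 * (S.C + S.κ) * S.κ * (S.u * S.ell) := by
    calc _ ≤ 2 * S.κ / S.lam ^ 2 * ((S.C + S.κ) * S.ell) :=
          mul_le_mul (h.p_mul_w_le a) (h.sum_three_le s.U) h3n (by positivity)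
      _ = 2 * (S.C + S.κ) * S.κ * S.lam := by rw [ell]; field_simp
      _ ≤ _ := mul_le_mul_of_nonneg_left h.lam_le (by positivity)
  have e3 : (1 + S.u - S.η₁ * S.u - S.C * S.time s / S.ell) * S.ell
      = S.ell + S.u * S.ell - S.η₁ * (S.u * S.ell) - S.C * S.time s := by
    field_simp
  rw [e3, η₁_eq]
  have h12 := mul_le_mul_of_nonneg_right h.κ_low₁ hul.le
  have h13 : S.ell + S.u * S.ell - 2 * S.κ * (S.u * S.ell) ≤ (1 + S.u) * (∑ v, S.w v ^ 2) := by
    have h14 := mul_le_mul_of_nonneg_left h1 (by linarith : 0 ≤ 1 + S.u)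
    have h15 : S.u * (S.κ * (S.u * S.ell)) ≤ 1 * (S.κ * (S.u * S.ell)) :=
      mul_le_mul_of_nonneg_right (by linarith [h.u_le, h.κ_le]) (mul_pos h5 hul).le
    linarith
  have hu2 : 1 + S.u ≤ 2 := by linarith [h.u_le, h.κ_le]
  have h16 : (1 + S.u) * (1 / (S.δ * S.f * S.lam) * ∑ u ∈ s.U, S.w u ^ 3)
      ≤ 2 * (S.δ * (S.u * S.ell) / 2) :=
    mul_le_mul hu2 h3 (mul_nonneg h.rate_snd_pos.le h3n) two_pos.le
  have h17 : (1 + S.u) * (S.p * S.w a * ∑ u ∈ s.U, S.w u ^ 3)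
      ≤ 2 * (2 * (S.C + S.κ) * S.κ * (S.u * S.ell)) :=
    mul_le_mul hu2 hp3 (mul_nonneg (mul_pos h.p_pos (h.w_pos a)).le h3n) two_pos.le
  have hq : 0 ≤ ∑ v ∈ s.Uᶜ, S.w v ^ 2 := Finset.sum_nonneg fun _ _ => sq_nonneg _
  have h18 : S.u * ∑ v ∈ s.Uᶜ, S.w v ^ 2 ≤ S.δ * (S.u * S.ell) := by
    have h20 : S.u * ∑ v ∈ s.Uᶜ, S.w v ^ 2 ≤ S.κ * (7 * (S.u * S.ell)) :=
      mul_le_mul h.u_le hq7 hq h5.le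
    have := mul_le_mul_of_nonneg_right h.κ_δ hul.le
    linarith
  have h19 := mul_pos h7 hul
  linarith

/-- The exponentials of the deviations are supermartingales. -/
lemma integral_exp_expo_le (i : Fin 6) :
    ∫ ω, Real.exp (S.expo (s.next a (nbrs ω a s.U)) i) ∂(edgeLaw S.w S.p)
      ≤ Real.exp (S.expo s i) := by
  have hr := h.rate_fst_pos.le
  have hr' := h.rate_snd_pos.le
  have hell := h.ell_pos
  fin_cases i
  · refine integral_exp_disc_le hs h ha (fun v => sq_nonneg (S.w v)) hr (fun v => ?_)
      (fun t => (S.C + S.δ) * t) (c := S.C + S.δ) (by linarith) (slope_sq_le h)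
    calc _ ≤ 1 / (S.δ * S.lam ^ 2) * (S.κ ^ 2 * S.lam ^ 2) :=
          mul_le_mul_of_nonneg_left (h.w_sq_le v) hr
      _ = _ := h.rate_fst_mul_sq
      _ ≤ 1 := h.κ_sq_div_le_one
  · exact integral_exp_neg_disc_le hs h ha (fun v => sq_nonneg (S.w v)) hr
      (fun t => (S.C - S.δ) * t) (c := S.C - S.δ) (by linarith) (le_slope_sq hs h)
  · refine integral_exp_disc_le hs h ha (fun v => zero_le_one) hr (fun v => ?_)
      (fun t => (1 + S.δ) * t) (c := 1 + S.δ) (by linarith) (slope_one_le h)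
    rw [mul_one]
    exact h.rate_fst_le.trans h.κ_sq_div_le_one
  · exact integral_exp_neg_disc_le hs h ha (fun v => zero_le_one) hr
      (fun t => (1 - S.δ) * t) (c := 1 - S.δ) (by linarith) (le_slope_one hs h)
  · refine integral_exp_disc_le hs h ha h.w_nonneg hr' h.rate_snd_mul_w_le
      (S.path (S.η₁ * S.u)) ?_ (slope_weight_le hs h (a := a))
    refine le_of_eq ?_
    simp only [path]
    field_simp; ring
  · refine integral_exp_neg_disc_le hs h ha h.w_nonneg hr'
      (S.path (-(S.η₁ * S.u))) ?_ (le_slope_weight hs h (a := a))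
    have : 0 ≤ S.C * S.w a ^ 2 / (2 * S.ell) := by
      have := h.C_pos; positivity
    have e : S.path (-(S.η₁ * S.u)) (S.time s + S.w a) - S.path (-(S.η₁ * S.u)) (S.time s)
        = (1 + S.u - S.η₁ * S.u - S.C * S.time s / S.ell) * S.w a
          - S.C * S.w a ^ 2 / (2 * S.ell) := by
      simp only [path]
      field_simp; ring
    linarith

end Step
/-! ### The end of the exploration -/

variable (S) in
/-- The stopping rule: control is lost, or the giant component has been explored. -/
def Stop (s : State n) : Prop :=
  ¬ S.Struct s ∨ (∃ i, 0 ≤ S.expo s i) ∨ (s.A = ∅ ∧ 2 * S.η * S.x < S.time s)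

lemma good_of_not_stop {s : State n} (hs : ¬ S.Stop s) : S.Good s := by
  simp only [Stop, not_or, not_not, not_exists, not_le] at hs
  exact ⟨hs.1, hs.2.1⟩

lemma time_le_of_not_stop {s : State n} (hs : ¬ S.Stop s) (hA : s.A = ∅) :
    S.time s ≤ 2 * S.η * S.x := by
  simp only [Stop, not_or, not_and, not_lt] at hs
  exact hs.2.2 hA

/-- Without active vertices the walk is nonpositive, so `y = t/x` satisfies `y (1 - y) < η` up to
the controlled error. Thus `y` is near 0 or beyond nearly 1, and `y > 2η` rules out the former. -/
lemma Good.le_time {s : State n} (hs : S.Good s) (h : S.Valid) (hA : s.A = ∅)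
    (ht : 2 * S.η * S.x < S.time s) : (1 - 2 * S.η) * S.x ≤ S.time s := by
  have h1 := hs.lt_walk h
  rw [hA, Finset.sum_empty] at h1
  have h2 := h.sum_weight_nonneg s.R
  have h3 := hs.walk_err h
  have hx := h.x_pos; have hu := h.u_pos
  have hux := mul_pos hu hx
  set y := S.time s / S.x with hy
  have hty : S.time s = y * S.x := by rw [hy]; field_simp
  have h4 : S.u * S.time s * (1 - y) < S.η * S.u * S.x := by linarith
  have h5 : y * (1 - y) < S.η := by
    rw [hty] at h4
    have : S.u * S.x * (y * (1 - y)) < S.u * S.x * S.η := by linarith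
    exact lt_of_mul_lt_mul_left this hux.le
  rw [hty] at ht ⊢
  have h6 : 2 * S.η < y := lt_of_mul_lt_mul_right ht hx.le
  refine mul_le_mul_of_nonneg_right ?_ hx.le
  by_contra hcon
  push Not at hcon
  have h7 := h.η_pos; have h8 := h.η_le
  nlinarith [mul_pos (sub_pos.2 h6) (sub_pos.2 hcon)]

/-- Once the giant component has been removed, the graph is subcritical. -/
lemma Good.subcritical {s : State n} (hs : S.Good s) (h : S.Valid) (hA : s.A = ∅)
    (ht : 2 * S.η * S.x < S.time s) : S.p * ∑ v ∈ s.U, S.w v ^ 2 ≤ 1 - S.u / 2 := by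
  have h1 := hs.le_time h hA ht
  have h2 := hs.lt_sum_sq_compl h
  have h3 := h.sum_two_le
  have h4 := hs.δ_time_le h
  have h5 := h.κ_pos; have h6 := h.ell_pos; have h7 := h.δ_pos; have h8 := h.u_pos
  have hC := h.C_pos; have hul := mul_pos h8 h6
  have hq : 0 ≤ ∑ v ∈ s.Uᶜ, S.w v ^ 2 := Finset.sum_nonneg fun _ _ => sq_nonneg _
  rw [sum_add_sum_compl' s.U (fun v => S.w v ^ 2), h.p_mul_le_iff]
  have h13 : (1 + S.u) * (∑ v, S.w v ^ 2) ≤ S.ell + S.u * S.ell + 2 * S.κ * (S.u * S.ell) := by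
    have h14 := mul_le_mul_of_nonneg_left h3 (by linarith : 0 ≤ 1 + S.u)
    have h15 : S.u * (S.κ * (S.u * S.ell)) ≤ 1 * (S.κ * (S.u * S.ell)) :=
      mul_le_mul_of_nonneg_right (by linarith [h.u_le, h.κ_le]) (mul_pos h5 hul).le
    linarith
  have h17 : 0 ≤ S.u * ∑ v ∈ s.Uᶜ, S.w v ^ 2 := mul_nonneg h8.le hq
  have h18 : S.C * ((1 - 2 * S.η) * S.x) ≤ S.C * S.time s := mul_le_mul_of_nonneg_left h1 hC.le
  have h19 : S.C * ((1 - 2 * S.η) * S.x) = 2 * (1 - 2 * S.η) * (S.u * S.ell) := by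
    linear_combination (1 - 2 * S.η) * h.C_mul_x
  -- At time `x` the drift `1 + u - Ct/ℓ` equals `1 - u`; keeping only `1 - u/2` leaves room for all
  -- errors.
  have h20 : 2 * S.κ + 4 * S.η + S.δ * (4 / S.C) + S.δ ≤ 1 / 2 := by
    have h21 : S.δ * (4 / S.C) ≤ S.η₁ := by rw [η₁_eq]; linarith
    have h22 := h.four_η₁
    have h23 := mul_pos h7 hC
    have h24 := h.δ_η
    have h25 := h.κ_δ
    have h26 := h.η_le
    linarith
  have h27 := mul_le_mul_of_nonneg_right h20 hul.le
  linarith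

lemma exp_sub_one_le_two_mul {g : ℝ} (h0 : 0 ≤ g) (h1 : g ≤ 1) : Real.exp g - 1 ≤ 2 * g := by
  have := Real.abs_exp_sub_one_sub_id_le (x := g) (by rwa [abs_of_nonneg h0])
  nlinarith [(abs_le.1 this).2]

/-- With `θ = 1/λ`, the subcritical gap `θu/2 = f/(2λ²)` pays for the quadratic terms, at most
`4(C+1)/λ²`, and for a count rate `γ = f/(16λ²)`. Then `γ x/2 = f²/(16C) ≥ 2f`. Summing over
starting vertices costs a factor `4λ²`, which division by the cluster size `x/2 = fλ²/C`
compensates. -/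
lemma Good.edgeLaw_bigCluster_le {s : State n} (hs : S.Good s) (h : S.Valid) (hA : s.A = ∅)
    (ht : 2 * S.η * S.x < S.time s) :
    (edgeLaw S.w S.p).real (bigCluster s.U (S.x / 2)) ≤ Real.exp (-S.f) := by
  have hl := h.lam_pos; have hf := h.f_pos; have hC := h.C_pos; have hell := h.ell_pos
  have hκ := h.κ_pos; have hl1 := h.one_le_lam
  set θ := 1 / S.lam with hθ
  set γ := S.f / (16 * S.lam ^ 2) with hγ
  have hθ0 : 0 < θ := by positivity
  have hγ0 : 0 < γ := by positivity
  have hγκ : γ ≤ S.κ / 16 := by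
    rw [hγ, div_le_div_iff₀ (by positivity) (by norm_num)]
    have h1 : S.κ * S.lam ≤ S.κ * S.lam ^ 2 :=
      mul_le_mul_of_nonneg_left (by nlinarith) hκ.le
    linarith [h.f_le]
  have hθw : ∀ v, θ * S.w v ≤ S.κ := fun v => by
    rw [hθ, one_div, inv_mul_le_iff₀ hl, mul_comm]; exact h.w_le v
  have h1 : ∀ v, θ * S.w v + γ ≤ 1 := fun v => by linarith [hθw v, h.κ_le]
  have hg0 : ∀ v, 0 ≤ θ * S.w v + γ := fun v =>
    add_nonneg (mul_nonneg hθ0.le (h.w_nonneg v)) hγ0.le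
  have hsumU : ∑ v ∈ s.U, S.w v ≤ S.ell := by
    rw [ell, ← h.sum_one]
    exact Finset.sum_le_sum_of_subset_of_nonneg (Finset.subset_univ _) fun i _ _ => h.w_nonneg i
  have hc : S.p * (∑ v ∈ s.U, S.w v * (θ * S.w v + γ)
      + ∑ v ∈ s.U, S.w v * (θ * S.w v + γ) ^ 2) ≤ θ := by
    have e1 : ∑ v ∈ s.U, S.w v * (θ * S.w v + γ)
        = θ * ∑ v ∈ s.U, S.w v ^ 2 + γ * ∑ v ∈ s.U, S.w v := by
      rw [Finset.mul_sum, Finset.mul_sum, ← Finset.sum_add_distrib]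
      exact Finset.sum_congr rfl fun v _ => by ring
    have e2 : ∑ v ∈ s.U, S.w v * (θ * S.w v + γ) ^ 2
        ≤ 2 * θ ^ 2 * ∑ v ∈ s.U, S.w v ^ 3 + 2 * γ ^ 2 * ∑ v ∈ s.U, S.w v := by
      rw [Finset.mul_sum, Finset.mul_sum, ← Finset.sum_add_distrib]
      refine Finset.sum_le_sum fun v _ => ?_
      nlinarith [mul_nonneg (h.w_nonneg v) (sq_nonneg (θ * S.w v - γ))]
    have e3 := mul_le_mul_of_nonneg_left (h.sum_three_le s.U) (by positivity : 0 ≤ 2 * θ ^ 2)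
    have e4 : γ * ∑ v ∈ s.U, S.w v ≤ γ * S.ell := mul_le_mul_of_nonneg_left hsumU hγ0.le
    have e5 : 2 * γ ^ 2 * ∑ v ∈ s.U, S.w v ≤ γ * S.ell := by
      have := h.κ_le
      exact mul_le_mul (by nlinarith) hsumU (h.sum_weight_nonneg _) hγ0.le
    have e6 := mul_le_mul_of_nonneg_left (hs.subcritical h hA ht) hθ0.le
    have e7 : 2 * θ ^ 2 * ((S.C + S.κ) * S.ell) ≤ 2 * θ ^ 2 * ((S.C + 1) * S.ell) := by
      refine mul_le_mul_of_nonneg_left (mul_le_mul_of_nonneg_right ?_ hell.le) (by positivity)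
      linarith [h.κ_le]
    set Y := 2 * θ ^ 2 * ((S.C + 1) * S.ell) + 2 * (γ * S.ell) with hY
    have hY0 : 0 ≤ Y := by positivity
    have e8 : S.p * Y ≤ θ * (S.u / 2) := by
      calc S.p * Y ≤ 2 / S.ell * Y := mul_le_mul_of_nonneg_right h.p_le hY0
        _ = (4 * (S.C + 1) + S.f / 4) / S.lam ^ 2 := by
          rw [hY, hθ, hγ]; field_simp; ring
        _ ≤ (S.f / 2) / S.lam ^ 2 := by
          refine div_le_div_of_nonneg_right ?_ (by positivity)
          linarith [h.f_C]
        _ = _ := by rw [hθ, u]; field_simp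
    have e9 : S.p * (∑ v ∈ s.U, S.w v * (θ * S.w v + γ)
        + ∑ v ∈ s.U, S.w v * (θ * S.w v + γ) ^ 2)
        ≤ S.p * (θ * ∑ v ∈ s.U, S.w v ^ 2 + Y) :=
      mul_le_mul_of_nonneg_left (by linarith) h.p_pos.le
    linarith
  have hm : 0 < S.x / 2 := half_pos h.x_pos
  refine (RankOne.edgeLaw_bigCluster_le h.w_nonneg h.p_pos.le hθ0.le hγ0 hm h1 hc).trans ?_
  have hmx : S.x / 2 = S.f * S.lam ^ 2 / S.C := by
    rw [x]; have := h.u_mul_ell; rw [mul_assoc, this]; ring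
  have hγm : 2 * S.f ≤ γ * (S.x / 2) := by
    have : γ * (S.x / 2) = S.f * (S.f / (16 * S.C)) := by rw [hmx, hγ]; field_simp
    rw [this]
    have : 2 ≤ S.f / (16 * S.C) := by
      rw [le_div_iff₀ (by positivity)]; linarith [h.f_C]
    nlinarith
  have hD : Real.exp S.f ≤ Real.exp (γ * (S.x / 2)) - 1 := by
    have h2 := Real.exp_le_exp.2 hγm
    have h3 : Real.exp (2 * S.f) = Real.exp S.f * Real.exp S.f := by rw [← Real.exp_add]; ring_nf
    have h4 := Real.add_one_le_exp S.f
    have h5 := h.one_le_f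
    nlinarith
  have hD0 : 0 < Real.exp (γ * (S.x / 2)) - 1 := lt_of_lt_of_le (Real.exp_pos _) hD
  have hsum : ∑ v ∈ s.U, (Real.exp (θ * S.w v + γ) - 1) / (Real.exp (γ * (S.x / 2)) - 1)
      ≤ 4 * S.lam ^ 2 / Real.exp S.f := by
    rw [← Finset.sum_div]
    refine div_le_div₀ (by positivity) ?_ (Real.exp_pos _) hD
    calc ∑ v ∈ s.U, (Real.exp (θ * S.w v + γ) - 1) ≤ ∑ v, 2 * (θ * S.w v + γ) := by
          refine le_trans (Finset.sum_le_sum fun v _ => exp_sub_one_le_two_mul (hg0 v) (h1 v))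
            (Finset.sum_le_sum_of_subset_of_nonneg (Finset.subset_univ _) fun v _ _ => ?_)
          linarith [hg0 v]
      _ = 2 * (θ * S.lam ^ 3 + n * γ) := by
          rw [← Finset.mul_sum, Finset.sum_add_distrib, ← Finset.mul_sum, h.sum_one]
          simp
      _ ≤ 4 * S.lam ^ 2 := by
          have h2 : θ * S.lam ^ 3 = S.lam ^ 2 := by rw [hθ]; field_simp
          have h3 : (n : ℝ) * γ ≤ S.c₄ * S.lam ^ 3 * γ :=
            mul_le_mul_of_nonneg_right h.card_le hγ0.le
          have h4 : S.c₄ * S.lam ^ 3 * γ = S.c₄ * S.lam * S.f / 16 := by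
            rw [hγ]; field_simp
          have h5 : 0 ≤ S.c₄ := by
            have : 0 ≤ S.c₄ * S.lam ^ 3 := le_trans (Nat.cast_nonneg n) h.card_le
            exact nonneg_of_mul_nonneg_left this (by positivity)
          have h6 : S.c₄ * S.lam * S.f ≤ S.c₄ * S.lam * (S.κ * S.lam) :=
            mul_le_mul_of_nonneg_left h.f_le (by positivity)
          have h7 : S.c₄ * S.κ * S.lam ^ 2 ≤ 1 * S.lam ^ 2 :=
            mul_le_mul_of_nonneg_right h.κ_c₄ (by positivity)
          have h8 : 0 ≤ S.lam ^ 2 := by positivity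
          linarith
  calc _ ≤ 4 * S.lam ^ 2 / Real.exp S.f / (S.x / 2) := div_le_div_of_nonneg_right hsum hm.le
    _ = 4 * S.C / S.f * Real.exp (-S.f) := by
        rw [hmx, Real.exp_neg]; field_simp
    _ ≤ _ := by
        refine mul_le_of_le_one_left (Real.exp_pos _).le ?_
        rw [div_le_one hf]; linarith [h.f_C]

variable (S) in
/-- The failure event at the end of the exploration. -/
def Fail (s : State n) : Set (Slot n → Bool) :=
  {ω | (∃ i, 0 ≤ S.expo s i) ∨
    (S.Good s ∧ s.A = ∅ ∧ 2 * S.η * S.x < S.time s ∧ ω ∈ bigCluster s.U (S.x / 2))}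

/-- The state before the exploration. -/
def _root_.RankOne.State.init (n : ℕ) : State n := ⟨∅, Finset.univ, ∅⟩

/-- The supermartingale is the sum of the six exponentials plus the constant `exp (-f)`. Loss of
control makes one exponential at least 1, and the constant pays for a big cluster in the subcritical
remainder; the initial value is `7 exp (-f)`. -/
theorem edgeLaw_fail_le (h : S.Valid) (k : ℕ) :
    (edgeLaw S.w S.p).real {ω | S.Stop ((State.init n).run S.mid S.Stop ω k) ∧
      ω ∈ S.Fail ((State.init n).run S.mid S.Stop ω k)} ≤ 7 * Real.exp (-S.f) := by
  set Ψ : State n → ℝ := fun s => ∑ i, Real.exp (S.expo s i) + Real.exp (-S.f) with hΨ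
  have hΨ0 : ∀ s, 0 ≤ Ψ s := fun s =>
    add_nonneg (Finset.sum_nonneg fun _ _ => (Real.exp_pos _).le) (Real.exp_pos _).le
  have key := edgeLaw_run_le S.w S.p S.mid S.Stop Ψ S.Fail
    (fun s hs => (good_of_not_stop hs).disjoint_AU)
    (fun s ω ω' hω hF => by
      rcases hF with hF | ⟨h1, h2, h3, h4⟩
      · exact Or.inl hF
      · exact Or.inr ⟨h1, h2, h3, determinedBy_bigCluster _ _ ω ω'
          (fun e he => hω e (slotsIn_mono Finset.subset_union_right he)) h4⟩)
    hΨ0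
    (fun s _ => by
      by_cases h1 : ∃ i, 0 ≤ S.expo s i
      · obtain ⟨i, hi⟩ := h1
        refine measureReal_le_one.trans ?_
        have h2 : Real.exp (S.expo s i) ≤ ∑ i, Real.exp (S.expo s i) :=
          Finset.single_le_sum (f := fun i => Real.exp (S.expo s i))
            (fun _ _ => (Real.exp_pos _).le) (Finset.mem_univ i)
        have h3 := Real.one_le_exp hi
        have h4 := Real.exp_pos (-S.f)
        simp only [hΨ]; linarith
      · by_cases h2 : S.Good s ∧ s.A = ∅ ∧ 2 * S.η * S.x < S.time s
        · have h3 : S.Fail s ⊆ bigCluster s.U (S.x / 2) := by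
            rintro ω (hω | hω)
            · exact absurd hω h1
            · exact hω.2.2.2
          refine (measureReal_mono h3).trans ((h2.1.edgeLaw_bigCluster_le h h2.2.1 h2.2.2).trans ?_)
          exact le_add_of_nonneg_left (Finset.sum_nonneg fun _ _ => (Real.exp_pos _).le)
        · have h3 : S.Fail s = ∅ := by
            ext ω
            simp only [Fail, Set.mem_ofPred_eq, Set.mem_empty_iff_false, iff_false]
            tauto
          rw [h3, measureReal_empty]
          exact hΨ0 s)
    (fun s r hs hA hr => by
      have hd := (good_of_not_stop hs).disjoint_RU
      have : ∀ i, S.expo (s.addRoot r) i = S.expo s i := fun i => by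
        rw [expo, expo, dev_addRoot hA hd hr]
      simp only [hΨ, this, le_refl])
    (fun s a hs ha => by
      simp only [hΨ]
      rw [integral_add (integrable_edgeLaw _ _ _) (integrable_const _),
        integral_finsetSum _ fun _ _ => integrable_edgeLaw _ _ _]
      simp only [integral_const, probReal_univ, one_smul]
      gcongr with i
      exact integral_exp_expo_le (good_of_not_stop hs) h ha i)
    k (State.init n)
  refine key.trans (le_of_eq ?_)
  have ht : S.time (State.init n) = 0 := by simp [time, State.init]
  have hdisc : ∀ g, disc g (State.init n) = 0 := fun g => by simp [disc, State.init]
  have he : ∀ i, S.expo (State.init n) i = -S.f := by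
    intro i
    have : S.dev (State.init n) i = 0 := by
      fin_cases i <;> simp [dev, hdisc, ht, path]
    rw [expo, this]; ring
  simp only [hΨ, he, Finset.sum_const, Finset.card_univ, Fintype.card_fin, nsmul_eq_mul]
  push_cast; ring

/-! ### The component structure seen by the exploration -/

variable (S) in
/-- The invariant of the exploration of `G`: the component under exploration contains everything
discovered, except for a small union `B` of components. -/
structure Inv (G : SimpleGraph (Fin n)) (s : State n) : Prop extends S.Struct s where
  no_edge : ∀ v ∉ s.A ∪ s.U, ∀ u ∈ s.U, ¬ G.Adj v u
  past : ∃ B : Finset (Fin n), Disjoint B (s.A ∪ s.U) ∧ (∀ b ∈ B, ∀ v ∉ B, ¬ G.Adj b v) ∧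
    ∑ v ∈ B, S.w v ≤ 2 * S.η * S.x ∧ (B.card : ℝ) ≤ 4 * S.η * S.x ∧
    ∀ v v', v ∉ B ∪ s.U → v' ∉ B ∪ s.U → G.Reachable v v'

lemma inv_init (h : S.Valid) (G : SimpleGraph (Fin n)) : S.Inv G (State.init n) := by
  have hx := h.x_pos; have hη := h.η_pos; have hu := h.u_pos
  refine ⟨⟨by simp [State.init], by simp [State.init], by simp [State.init], ?_⟩,
    by simp [State.init], ∅, by simp, by simp, ?_, ?_, by simp [State.init]⟩
  · simp only [State.init, Finset.sum_empty]; positivity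
  · simp only [Finset.sum_empty]; positivity
  · simp only [Finset.card_empty, Nat.cast_zero]; positivity

/-- A new root keeps the total weight of the roots small. -/
lemma root_weight_addRoot (h : S.Valid) {s : State n} (hs : ¬ S.Stop s) (hA : s.A = ∅)
    {r : Fin n} (hr : r ∈ S.mid) : ∑ v ∈ s.R, S.w v + S.w r ≤ S.η * S.u * S.x := by
  have hG := good_of_not_stop hs
  have ht := time_le_of_not_stop hs hA
  have h1 := hG.lt_walk h
  rw [hA, Finset.sum_empty] at h1
  have hx := h.x_pos; have hu := h.u_pos; have h0 := h.time_nonneg s; have hl := h.lam_pos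
  have h2 : S.time s ≤ S.x := by
    have := h.η_le
    nlinarith
  -- With no active vertex the walk is minus the root weight. Before time `x` the parabola is
  -- nonnegative, so that weight is bounded by the walk error alone, and this leaves room for one
  -- more root of weight at most `c₂`.
  have h3 : 0 ≤ S.u * S.time s * (1 - S.time s / S.x) := by
    have : S.time s / S.x ≤ 1 := (div_le_one hx).2 h2
    exact mul_nonneg (mul_nonneg hu.le h0) (by linarith)
  have h4 : S.η₁ * S.u * S.time s ≤ S.η₁ * S.u * S.x :=
    mul_le_mul_of_nonneg_left h2 (mul_pos h.η₁_pos hu).le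
  have h5 : S.w r ≤ S.δ * (S.u * (S.u * S.ell)) := by
    have h6 : S.lam ≤ S.u * (S.u * S.ell) := by
      have : S.u * (S.u * S.ell) = S.f ^ 2 * S.lam := by
        rw [h.u_mul_ell, ← h.u_mul_lam]; ring
      rw [this]
      nlinarith [one_le_pow₀ h.one_le_f (n := 2)]
    calc S.w r ≤ S.c₂ * 1 := by rw [mul_one]; exact hr.2
      _ ≤ S.c₂ * (S.κ * S.lam) := mul_le_mul_of_nonneg_left h.one_le_κ_lam h.c₂_pos.le
      _ = S.c₂ * S.κ * S.lam := by ring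
      _ ≤ S.δ * (S.u * (S.u * S.ell)) := mul_le_mul h.κ_c₂ h6 hl.le h.δ_pos.le
  have h7 : S.δ * (S.u * (S.u * S.ell)) = S.u * S.x * (S.δ * S.C / 2) := by
    linear_combination (-S.δ * S.u / 2) * h.C_mul_x
  have h8 : 0 ≤ S.u * S.x * (S.η - S.η₁ - S.δ * S.C) := by
    refine mul_nonneg (mul_pos hu hx).le ?_
    have := h.four_η₁; have := h.η₁_pos
    linarith
  rw [h7] at h1 h5
  linarith

lemma Inv.step {ω : Slot n → Bool} (h : S.Valid) {s : State n} (hs : ¬ S.Stop s)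
    (hI : S.Inv (graphOf ω) s) : S.Inv (graphOf ω) (s.step S.mid ω) := by
  have hG := good_of_not_stop hs
  rcases s.step_cases S.mid ω with ⟨a, ha, hst⟩ | ⟨hA, r, hr, hm, hst⟩ | ⟨hA, _, hst⟩
  · rw [hst]
    have hN := nbrs_subset ω a s.U
    have haU : a ∉ s.U := Finset.disjoint_left.1 hI.disjoint_AU ha
    obtain ⟨B, hB1, hB2, hB3, hB4, hB5⟩ := hI.past
    have haB : a ∉ B := fun haB =>
      Finset.disjoint_left.1 hB1 haB (Finset.mem_union_left _ ha)
    refine ⟨⟨?_, ?_, hI.root_mid, hI.root_weight⟩, ?_, B, hB1.mono_right (s.next_subset hN), hB2,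
      hB3, hB4, ?_⟩
    · rw [State.next, Finset.disjoint_union_left]
      exact ⟨(hI.disjoint_AU.mono_left (Finset.erase_subset _ _)).mono_right
        Finset.sdiff_subset, Finset.disjoint_sdiff⟩
    · exact hI.disjoint_RU.mono_right Finset.sdiff_subset
    · intro v hv u hu hadj
      simp only [State.next, Finset.mem_union, Finset.mem_erase, Finset.mem_sdiff] at hv hu
      by_cases hva : v = a
      · subst hva
        exact hu.2 (mem_nbrs.2 ⟨hu.1, hadj⟩)
      · refine hI.no_edge v ?_ u hu.1 hadj
        simp only [Finset.mem_union]
        tauto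
    -- The vertex `a` serves as a hub: old discoveries outside `B` are connected to it by the
    -- invariant, and new ones are its neighbours.
    · have key : ∀ v, v ∉ B ∪ (s.next a (nbrs ω a s.U)).U → (graphOf ω).Reachable a v := by
        intro v hv
        simp only [State.next, Finset.mem_union, Finset.mem_sdiff, not_or, not_and, not_not] at hv
        by_cases hvU : v ∈ s.U
        · exact (mem_nbrs.1 (hv.2 hvU)).2.reachable
        · exact hB5 a v (by simp [haB, haU]) (by simp [hv.1, hvU])
      exact fun v v' hv hv' => (key v hv).symm.trans (key v' hv')
  · rw [hst]
    have hsub : (s.addRoot r).A ∪ (s.addRoot r).U = s.U := by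
      rw [State.addRoot, ← Finset.insert_eq, Finset.insert_erase hr]
    have hrR : r ∉ s.R := fun hrR => Finset.disjoint_left.1 hI.disjoint_RU hrR hr
    have hAU : s.A ∪ s.U = s.U := by rw [hA, Finset.empty_union]
    -- At a new root everything discovered so far becomes the new `B`. It is a union of components
    -- since nothing is active, and it is small because the stopping rule has not yet applied, so
    -- the clock shows at most `2ηx`.
    refine ⟨⟨by simp [State.addRoot], ?_, ?_, ?_⟩, ?_, s.Uᶜ, ?_, ?_, ?_, ?_, ?_⟩
    · rw [State.addRoot, Finset.disjoint_insert_left]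
      exact ⟨Finset.notMem_erase _ _, hI.disjoint_RU.mono_right (Finset.erase_subset _ _)⟩
    · intro v hv
      rcases Finset.mem_insert.1 hv with rfl | hv
      · exact hm
      · exact hI.root_mid v hv
    · rw [State.addRoot, Finset.sum_insert hrR, add_comm]
      exact root_weight_addRoot h hs hA hm
    · intro v hv u hu
      rw [hsub] at hv
      exact hI.no_edge v (by rwa [hAU]) u (Finset.mem_of_mem_erase hu)
    · rw [hsub]; exact disjoint_compl_left
    · intro b hb v hv
      exact hI.no_edge b (by rw [hAU]; simpa using hb) v (by simpa using hv)
    · have := time_le_of_not_stop hs hA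
      rwa [time, hAU] at this
    · have := hG.card_compl_le h
      have := time_le_of_not_stop hs hA
      linarith
    · intro v v' hv hv'
      simp only [State.addRoot, Finset.mem_union, Finset.mem_compl, Finset.mem_erase, not_or,
        not_not, not_and] at hv hv'
      have e1 : v = r := by by_contra hne; exact hv.2 hne hv.1
      have e2 : v' = r := by by_contra hne; exact hv'.2 hne hv'.1
      rw [e1, e2]
  · rw [hst]; exact hI

/-- Vertices of typical weight number at least `c₃ ℓ`, whereas before stopping with nothing active
only a small multiple of `x ≤ (6κ/C) ℓ` vertices have been discovered. -/
lemma exists_root (h : S.Valid) {s : State n} (hs : ¬ S.Stop s) (hA : s.A = ∅) :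
    ∃ r ∈ s.U, r ∈ S.mid := by
  by_contra hcon
  push Not at hcon
  have hG := good_of_not_stop hs
  have h1 := hG.card_compl_le h
  have h2 := time_le_of_not_stop hs hA
  have h3 : S.mid.ncard ≤ s.Uᶜ.card := by
    rw [← Set.ncard_coe_finset]
    refine Set.ncard_le_ncard (fun v hv => ?_) (Set.toFinite _)
    simpa using fun hvU => hcon v hvU hv
  have h4 : (S.mid.ncard : ℝ) ≤ (s.Uᶜ.card : ℝ) := by exact_mod_cast h3
  have h5 := h.mid_card
  have hx := h.x_pos; have hη := h.η_le
  have h6 : S.x ≤ 6 * S.κ / S.C * S.ell := by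
    have hC := h.C_pos; have hell := h.ell_pos
    have e : S.x = 2 * S.u / S.C * S.ell := by rw [x]; ring
    rw [e]
    refine mul_le_mul_of_nonneg_right (div_le_div_of_nonneg_right ?_ hC.le) hell.le
    linarith [h.u_le, h.κ_pos]
  have h7 := mul_lt_mul_of_pos_right h.κ_c₃ h.ell_pos
  change S.c₃ * S.ell ≤ _ at h5
  nlinarith

lemma compSize_eq {G : SimpleGraph (Fin n)} (c : G.ConnectedComponent) (X : Finset (Fin n))
    (hX : c.supp = X) : compSize c = X.card := by
  rw [compSize, hX, Set.ncard_coe_finset]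

lemma compWeight_eq (w : Fin n → ℝ) {G : SimpleGraph (Fin n)} (c : G.ConnectedComponent)
    (X : Finset (Fin n)) (hX : c.supp = X) : compWeight w c = ∑ v ∈ X, w v := by
  rw [compWeight]
  refine Finset.sum_congr ?_ fun _ _ => rfl
  ext v; simp [hX]

lemma compSize_le {G : SimpleGraph (Fin n)} (c : G.ConnectedComponent) (X : Finset (Fin n))
    (hX : c.supp ⊆ X) : compSize c ≤ X.card := by
  rw [compSize, ← Set.ncard_coe_finset]
  exact Set.ncard_le_ncard hX (Set.toFinite _)

/-- If the exploration does not fail, the largest component is the one it has found. -/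
theorem largest_of_not_fail (h : S.Valid) {ω : Slot n → Bool} {s : State n}
    (hI : S.Inv (graphOf ω) s) (hS : S.Stop s) (hF : ω ∉ S.Fail s)
    {c : (graphOf ω).ConnectedComponent} (hc : IsLargest c) :
    ((1 - 7 * S.η) * S.x ≤ compSize c ∧ (compSize c : ℝ) ≤ (1 + 5 * S.η) * S.x) ∧
      ((1 - 4 * S.η) * S.x ≤ compWeight S.w c ∧ compWeight S.w c ≤ (1 + 3 * S.η) * S.x) := by
  simp only [Fail, Set.mem_ofPred_eq, not_or] at hF
  obtain ⟨hF1, hF2⟩ := hF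
  have hgood : S.Good s := by
    refine ⟨hI.toStruct, fun i => ?_⟩
    by_contra hcon
    exact hF1 ⟨i, not_lt.1 hcon⟩
  obtain ⟨hA, ht⟩ : s.A = ∅ ∧ 2 * S.η * S.x < S.time s := by
    rcases hS with hS | hS | hS
    · exact absurd hI.toStruct hS
    · exact absurd hS hF1
    · exact hS
  have hbig : ω ∉ bigCluster s.U (S.x / 2) := fun hb => hF2 ⟨hgood, hA, ht, hb⟩
  have hAU : s.A ∪ s.U = s.U := by rw [hA, Finset.empty_union]
  have hno := hI.no_edge
  obtain ⟨B, hB1, hB2, hB3, hB4, hB5⟩ := hI.past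
  rw [hAU] at hno hB1
  have hBU : B ⊆ s.Uᶜ := fun b hb => Finset.mem_compl.2 (Finset.disjoint_left.1 hB1 hb)
  have htime : S.time s = ∑ v ∈ s.Uᶜ, S.w v := by rw [time, hAU]
  have hx := h.x_pos; have hη := h.η_pos; have hη' := h.η_le
  have hlow := hgood.le_time h hA ht
  have hup := hgood.time_le h
  have hcard1 := hgood.card_compl_le h
  have hcard2 := hgood.le_card_compl h
  have hKcard : ((s.Uᶜ \ B).card : ℝ) = (s.Uᶜ).card - B.card := by
    rw [Finset.card_sdiff_of_subset hBU, Nat.cast_sub (Finset.card_le_card hBU)]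
  have hKw : ∑ v ∈ s.Uᶜ \ B, S.w v = S.time s - ∑ v ∈ B, S.w v := by
    rw [htime, ← Finset.sum_sdiff hBU]; ring
  have hBcard0 : (0 : ℝ) ≤ B.card := Nat.cast_nonneg _
  have hBw0 := h.sum_weight_nonneg B
  have hKlow : (1 - 7 * S.η) * S.x ≤ ((s.Uᶜ \ B).card : ℝ) := by rw [hKcard]; linarith
  have hηx : S.η * S.x ≤ 1 / 100 * S.x := mul_le_mul_of_nonneg_right hη' hx.le
  have hhalf : S.x / 2 < (1 - 7 * S.η) * S.x := by linarith
  have hKpos : 0 < (s.Uᶜ \ B).card := by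
    have : (0 : ℝ) < ((s.Uᶜ \ B).card : ℝ) := by linarith
    exact_mod_cast this
  obtain ⟨v₀, hv₀⟩ := Finset.card_pos.1 hKpos
  -- The discovered set without `B` is connected and no edge leaves it, so it is exactly one
  -- component.
  have hsuppK : ∀ v ∈ s.Uᶜ \ B, ((graphOf ω).connectedComponentMk v).supp =
      ((s.Uᶜ \ B : Finset _) : Set _) := by
    intro v hv
    ext z
    rw [SimpleGraph.ConnectedComponent.mem_supp_iff, SimpleGraph.ConnectedComponent.eq]
    constructor
    · intro hz
      refine mem_of_reachable (S := ((s.Uᶜ \ B : Finset _) : Set (Fin n))) ?_ hv hz.symm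
      intro a b ha hab
      simp only [Finset.coe_sdiff, Finset.coe_compl, Set.mem_sdiff, Set.mem_compl_iff,
        Finset.mem_coe] at ha ⊢
      exact ⟨fun hb => hno a ha.1 b hb hab, fun hb => hB2 b hb a ha.2 hab.symm⟩
    · intro hz
      rw [Finset.mem_coe] at hz
      simp only [Finset.mem_sdiff, Finset.mem_compl] at hz hv
      exact hB5 z v (by simp [hz.1, hz.2]) (by simp [hv.1, hv.2])
  have hsize₀ : compSize ((graphOf ω).connectedComponentMk v₀) = (s.Uᶜ \ B).card :=
    compSize_eq _ _ (hsuppK v₀ hv₀)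
  have hclow : (1 - 7 * S.η) * S.x ≤ compSize c := by
    refine hKlow.trans ?_
    rw [← hsize₀]
    exact_mod_cast hc _
  -- A largest component has at least `(1 - 7η)x > x/2` vertices. One meeting `B` stays in `B` and
  -- has at most `4ηx`; one meeting `U` is a cluster of the undiscovered graph, hence smaller than
  -- `x/2`.
  have hsupp : c.supp = ((s.Uᶜ \ B : Finset _) : Set _) := by
    induction c using SimpleGraph.ConnectedComponent.ind with
    | h y =>
      by_cases hyK : y ∈ s.Uᶜ \ B
      · exact hsuppK y hyK
      exfalso
      by_cases hyB : y ∈ B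
      · have : ((graphOf ω).connectedComponentMk y).supp ⊆ (B : Set (Fin n)) := by
          intro z hz
          rw [SimpleGraph.ConnectedComponent.mem_supp_iff,
            SimpleGraph.ConnectedComponent.eq] at hz
          refine mem_of_reachable ?_ hyB hz.symm
          intro a b ha hab
          by_contra hb
          exact hB2 a ha b hb hab
        have h1 : (compSize ((graphOf ω).connectedComponentMk y) : ℝ) ≤ B.card := by
          exact_mod_cast compSize_le _ _ this
        linarith
      · have hyU : y ∈ s.U := by
          by_contra hyU
          exact hyK (by simp [hyU, hyB])
        have : ((graphOf ω).connectedComponentMk y).supp ⊆ (cluster (graphOf ω) s.U y : Set (Fin n)) := by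
          intro z hz
          rw [SimpleGraph.ConnectedComponent.mem_supp_iff,
            SimpleGraph.ConnectedComponent.eq] at hz
          have := mem_of_reachable (S := {z | z ∈ s.U ∧ (within (graphOf ω) s.U).Reachable y z}) (v := y)
            ?_ ⟨hyU, SimpleGraph.Reachable.refl _⟩ hz.symm
          · exact mem_cluster.2 this.2
          · rintro a b ⟨ha, hr⟩ hab
            have hb : b ∈ s.U := by
              by_contra hb
              exact hno b hb a ha hab.symm
            exact ⟨hb, hr.trans (SimpleGraph.Adj.reachable ⟨hab, ha, hb⟩)⟩
        have h1 : (compSize ((graphOf ω).connectedComponentMk y) : ℝ) ≤ (cluster (graphOf ω) s.U y).card := by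
          exact_mod_cast compSize_le _ _ this
        have h2 : ((cluster (graphOf ω) s.U y).card : ℝ) < S.x / 2 := by
          by_contra hcon
          exact hbig ⟨y, hyU, not_lt.1 hcon⟩
        linarith
  refine ⟨⟨hclow, ?_⟩, ?_⟩
  · rw [compSize_eq c _ hsupp, hKcard]; linarith
  · rw [compWeight_eq S.w c _ hsupp, hKw]
    constructor <;> linarith

/-- The largest component has the expected size and weight up to an exponentially small
probability. -/
theorem edgeLaw_not_giantEvent_le (h : S.Valid) {ε : ℝ} (hε : S.η = ε / 100) :
    (edgeLaw S.w (critParam (totalWeight S.w) S.f)).real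
      {ω | ¬ GiantEvent S.C ε S.f S.w (graphOf ω)} ≤ 7 * Real.exp (-S.f) := by
  have hl := h.lam_pos
  have htot : totalWeight S.w = S.lam ^ 3 := h.sum_one
  have hpow : ∀ k : ℕ, totalWeight S.w ^ ((k : ℝ) / 3) = S.lam ^ k := by
    intro k
    rw [htot, ← Real.rpow_natCast S.lam 3, ← Real.rpow_mul hl.le, ← Real.rpow_natCast S.lam k]
    congr 1
    push_cast; ring
  have h1 : totalWeight S.w ^ (1 / 3 : ℝ) = S.lam := by simpa using hpow 1
  have h2 : totalWeight S.w ^ (2 / 3 : ℝ) = S.lam ^ 2 := by simpa using hpow 2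
  have h4 : totalWeight S.w ^ (4 / 3 : ℝ) = S.lam ^ 4 := by simpa using hpow 4
  have hp : critParam (totalWeight S.w) S.f = S.p := by rw [critParam, h1, h4, p]
  rw [hp]
  refine le_trans (measureReal_mono fun ω hω => ?_) (edgeLaw_fail_le h (State.init n).potential)
  have hprog : ∀ s, ¬ S.Stop s → S.Inv (graphOf ω) s → S.Inv (graphOf ω) (s.step S.mid ω) :=
    fun s hs hI => hI.step h hs
  have hI := State.run_induct (Stop := S.Stop) hprog (State.init n).potential
    (inv_init h (graphOf ω))
  have hS := State.terminates (Stop := S.Stop) hprog (fun s hs _ hA => exists_root h hs hA)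
    (inv_init h (graphOf ω)) le_rfl
  refine ⟨hS, ?_⟩
  by_contra hF
  refine hω fun c hc => ?_
  obtain ⟨⟨a1, a2⟩, a3, a4⟩ := largest_of_not_fail h hI hS hF hc
  have hx := h.x_pos
  have hη := h.η_pos
  have hxe : S.x = 2 * S.f * S.lam ^ 2 / S.C := by
    rw [x, mul_assoc, h.u_mul_ell]; ring
  have e : ∀ b : ℝ, 2 * b * S.f * S.lam ^ 2 / S.C = b * S.x := fun b => by rw [hxe]; ring
  have hε' : ε = 100 * S.η := by rw [hε]; ring
  -- The term subtracted in the lower size bound only enlarges the interval; with `η = ε/100` the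
  -- errors `7η`, `5η`, `4η`, `3η` all lie well within `ε/2`.
  have hpos : 0 ≤ S.lam ^ 2 / S.C := div_nonneg (sq_nonneg _) h.C_pos.le
  have hηx := mul_pos hη hx
  rw [h2, e, e, e, e, hε']
  refine ⟨⟨?_, ?_⟩, ?_, ?_⟩ <;> linarith

end Setup

/-! ### Choice of the constants -/

/-- A smallness condition that holds strictly at 0 holds for all small positive arguments, so
finitely many can be met at once. -/
lemma eventually_le_of_continuous {g : ℝ → ℝ} (hg : Continuous g) {c : ℝ} (h0 : g 0 < c) :
    ∀ᶠ x in 𝓝[>] (0 : ℝ), g x ≤ c :=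
  ((hg.tendsto 0).mono_left nhdsWithin_le_nhds).eventually (ge_mem_nhds h0)

lemma exists_small_error {C η : ℝ} (hC : 0 < C) (hη : 0 < η) :
    ∃ δ : ℝ, 0 < δ ∧ δ ≤ 1 ∧ δ ≤ C / 4 ∧ δ * (2 + C / 2) ≤ η ∧
      4 * (δ * (4 / C + 6)) / C + 2 * δ ≤ 2 * η / C := by
  have h : ∀ᶠ δ in 𝓝[>] (0 : ℝ), 0 < δ ∧ δ ≤ 1 ∧ δ ≤ C / 4 ∧ δ * (2 + C / 2) ≤ η ∧
      4 * (δ * (4 / C + 6)) / C + 2 * δ ≤ 2 * η / C := by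
    filter_upwards [self_mem_nhdsWithin,
      eventually_le_of_continuous (g := fun δ => δ) (c := 1) (by fun_prop) (by norm_num),
      eventually_le_of_continuous (g := fun δ => δ) (c := C / 4) (by fun_prop) (by positivity),
      eventually_le_of_continuous (g := fun δ => δ * (2 + C / 2)) (c := η) (by fun_prop)
        (by simpa using hη),
      eventually_le_of_continuous (g := fun δ => 4 * (δ * (4 / C + 6)) / C + 2 * δ)
        (c := 2 * η / C) (by fun_prop) (by simp; positivity)] with δ h1 h2 h3 h4 h5
    exact ⟨h1, h2, h3, h4, h5⟩
  exact h.exists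

/-- All constants can be chosen compatibly. -/
lemma exists_constValid {C c₁ c₂ c₃ c₄ η δ K : ℝ} (hC : 0 < C) (hc₁ : 0 < c₁)
    (hc₂ : 0 < c₂) (hc₃ : 0 < c₃) (hη : 0 < η) (hη' : η ≤ 1 / 100) (hδ : 0 < δ)
    (hδ₁ : δ ≤ 1) (hδ₂ : δ ≤ C / 4) (hδ₃ : δ * (2 + C / 2) ≤ η)
    (hδ₄ : 4 * (δ * (4 / C + 6)) / C + 2 * δ ≤ 2 * η / C) (hK : 0 < K) :
    ∃ κ : ℝ, ∀ (n : ℕ) (w : Fin n → ℝ) (lam f : ℝ),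
      (Setup.mk w lam f C c₁ c₂ c₃ c₄ η δ K κ).ConstValid := by
  have h : ∀ᶠ κ in 𝓝[>] (0 : ℝ), ∀ (n : ℕ) (w : Fin n → ℝ) (lam f : ℝ),
      (Setup.mk w lam f C c₁ c₂ c₃ c₄ η δ K κ).ConstValid := by
    filter_upwards [self_mem_nhdsWithin,
      eventually_le_of_continuous (g := fun κ => κ) (c := 1 / 4) (by fun_prop) (by norm_num),
      eventually_le_of_continuous (g := fun κ => 7 * κ) (c := δ) (by fun_prop) (by simpa using hδ),
      eventually_le_of_continuous (g := fun κ => (1 + κ) * (C + κ) * (1 + κ ^ 2 / δ))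
        (c := C + δ) (by fun_prop) (by simpa using hδ),
      eventually_le_of_continuous (g := fun κ => κ + 7 * K * κ
        + (2 * κ ^ 2 + κ ^ 2 / δ) * (C + κ)) (c := 3 * δ / 4) (by fun_prop)
        (by simp; positivity),
      eventually_le_of_continuous (g := fun κ => (1 + κ) * (1 + κ ^ 2 / δ))
        (c := 1 + δ) (by fun_prop) (by simpa using hδ),
      eventually_le_of_continuous (g := fun κ => 6 * κ / C + 4 * κ + κ ^ 2 / δ)
        (c := δ) (by fun_prop) (by simpa using hδ),
      eventually_le_of_continuous (g := fun κ => 2 * κ + C * κ)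
        (c := δ) (by fun_prop) (by simpa using hδ),
      eventually_le_of_continuous (g := fun κ => 2 * κ + 4 * (C + κ) * κ)
        (c := δ) (by fun_prop) (by simpa using hδ),
      eventually_le_of_continuous (g := fun κ => c₂ * κ)
        (c := δ) (by fun_prop) (by simpa using hδ),
      eventually_le_of_continuous (g := fun κ => 2 * c₂ * κ / C)
        (c := δ) (by fun_prop) (by simpa using hδ),
      eventually_le_of_continuous (g := fun κ => κ) (c := c₁) (by fun_prop) hc₁,
      eventually_le_of_continuous (g := fun κ => 6 * κ / C)
        (c := c₃ / 2) (by fun_prop) (by simpa using hc₃),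
      eventually_le_of_continuous (g := fun κ => c₄ * κ)
        (c := 1) (by fun_prop) (by simp)]
      with κ a1 a2 a3 a4 a5 a6 a7 a8 a9 a10 a11 a12 a13 a14
    exact fun n w lam f => ⟨hC, hc₁, hc₂, hη, hη', hδ, hδ₁, hδ₂, hδ₃, hδ₄, hK, a1, a2, a3, a4, a5,
      a6, a7, a8, a9, a10, a11, a12, lt_of_le_of_lt a13 (by linarith), a14⟩
  exact h.exists

/-! ### Moments of the limit law -/

section Law
variable {ν : Measure ℝ} [IsProbabilityMeasure ν]

lemma integrable_id_of_cube (h3 : Integrable (fun x : ℝ => x ^ 3) ν) :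
    Integrable (fun x : ℝ => x ^ 1) ν := by
  refine Integrable.mono' ((integrable_const (1 : ℝ)).add h3.norm) (by fun_prop)
    (Eventually.of_forall fun x => ?_)
  simp only [pow_one, Real.norm_eq_abs, Pi.add_apply, abs_pow]
  have h0 := abs_nonneg x
  by_cases hx : |x| ≤ 1
  · have := pow_nonneg h0 3
    linarith
  · have := le_self_pow₀ (not_le.1 hx).le (n := 3) (by norm_num)
    linarith

lemma integral_pow_pos (hpos : ∀ᵐ x ∂ν, 0 < x) {k : ℕ}
    (hk : Integrable (fun x : ℝ => x ^ k) ν) : 0 < moment ν k := by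
  rw [moment, integral_pos_iff_support_of_nonneg_ae (hpos.mono fun x hx => (pow_pos hx k).le) hk]
  have : ν (Function.support fun x : ℝ => x ^ k) = 1 := by
    refine (prob_compl_eq_zero_iff₀ ?_).1 ?_
    · exact ((by fun_prop : Measurable fun x : ℝ => x ^ k) (measurableSet_singleton 0).compl
        ).nullMeasurableSet
    · refine measure_mono_null (fun x hx => ?_) hpos
      intro hx0
      exact hx (pow_pos hx0 k).ne'
  rw [this]; exact one_pos

/-- The cube of a number truncated to `[0, k]`. -/
def truncCube (k : ℕ) : ℝ →ᵇ ℝ :=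
  BoundedContinuousFunction.ofNormedAddCommGroup (fun x : ℝ => (max 0 (min x k)) ^ 3)
    (by fun_prop) ((k : ℝ) ^ 3) fun x => by
      rw [Real.norm_eq_abs, abs_of_nonneg (pow_nonneg (le_max_left _ _) 3)]
      exact pow_le_pow_left₀ (le_max_left _ _)
        (max_le (Nat.cast_nonneg k) (min_le_right _ _)) 3

lemma truncCube_apply (k : ℕ) (x : ℝ) : truncCube k x = (max 0 (min x k)) ^ 3 := rfl

omit [IsProbabilityMeasure ν] in
lemma tendsto_integral_truncCube (hpos : ∀ᵐ x ∂ν, 0 < x)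
    (h3 : Integrable (fun x : ℝ => x ^ 3) ν) :
    Tendsto (fun k => ∫ x, truncCube k x ∂ν) atTop (𝓝 (moment ν 3)) := by
  refine tendsto_integral_of_dominated_convergence (fun x => ‖x ^ 3‖)
    (fun k => (truncCube k).continuous.aestronglyMeasurable) h3.norm (fun k => ?_) ?_
  · filter_upwards [hpos] with x hx
    rw [truncCube_apply, norm_pow, norm_pow, Real.norm_eq_abs, Real.norm_eq_abs,
      abs_of_nonneg (le_max_left _ _), abs_of_pos hx]
    exact pow_le_pow_left₀ (le_max_left _ _) (max_le hx.le (min_le_left _ _)) 3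
  · filter_upwards [hpos] with x hx
    obtain ⟨m, hm⟩ := exists_nat_ge x
    refine tendsto_const_nhds.congr' ?_
    filter_upwards [eventually_ge_atTop m] with k hk
    have : x ≤ k := hm.trans (by exact_mod_cast hk)
    rw [truncCube_apply, min_eq_left this, max_eq_right hx.le]

end Law

/-! ### Consequences of the weight conditions -/

lemma eventually_abs_le {a : ℕ → ℝ} {r : ℝ} (ha : a =o[atTop] fun n : ℕ => (n : ℝ) ^ r)
    {s : ℝ} (hs : 0 < s) : ∀ᶠ n : ℕ in atTop, |a n| ≤ s * (n : ℝ) ^ r := by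
  filter_upwards [ha.def hs] with n hn
  rwa [Real.norm_eq_abs, Real.norm_eq_abs,
    abs_of_nonneg (Real.rpow_nonneg (Nat.cast_nonneg n) r)] at hn

open Classical in
/-- If the second moment of the weights is close to the first one, many weights are typical. -/
lemma card_typical {n : ℕ} {v : Fin n → ℝ} {m ℓ : ℝ} (hm : 0 < m) (hv : ∀ i, 0 < v i)
    (hℓ : ∑ i, v i = ℓ)
    (h1 : 9 / 10 * (m * n) ≤ ℓ) (h2 : ∑ i, v i ^ 2 ≤ 7 / 6 * ℓ) :
    1 / 16 * ℓ ≤ ({i | m / 4 ≤ v i ∧ v i ≤ 2} : Set (Fin n)).ncard := by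
  set T : Finset (Fin n) := Finset.univ.filter fun i => m / 4 ≤ v i ∧ v i ≤ 2 with hT
  have hcard : ({i | m / 4 ≤ v i ∧ v i ≤ 2} : Set (Fin n)).ncard = T.card := by
    rw [← Set.ncard_coe_finset]
    congr 1
    ext i; simp [hT]
  -- Light weights are covered by `m/4`, heavy ones by `v²/2`, typical ones by 2. Summing yields `ℓ
  -- ≤ (5/18) ℓ + (7/12) ℓ + 2|T|`, hence `|T| ≥ (5/72) ℓ`.
  have a1 : ∀ i ∈ Finset.univ, v i ≤ m / 4 + v i ^ 2 / 2 + (if i ∈ T then 2 else 0) := by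
    intro i _
    have hp := hv i
    by_cases h3 : 2 < v i
    · have h4 : (0 : ℝ) ≤ if i ∈ T then 2 else 0 := by split_ifs <;> norm_num
      have h5 : 2 * v i ≤ v i ^ 2 := by nlinarith
      linarith
    · by_cases h4 : m / 4 ≤ v i
      · rw [if_pos (by simp [hT, h4, not_lt.1 h3])]
        nlinarith [sq_nonneg (v i)]
      · have h5 : (0 : ℝ) ≤ if i ∈ T then 2 else 0 := by split_ifs <;> norm_num
        nlinarith [sq_nonneg (v i)]
  have a2 := Finset.sum_le_sum a1
  rw [Finset.sum_add_distrib, Finset.sum_add_distrib,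
    ← Finset.sum_div Finset.univ (fun i => v i ^ 2)] at a2
  simp only [Finset.sum_const, Finset.card_univ, Fintype.card_fin, nsmul_eq_mul,
    Finset.sum_ite_mem, Finset.univ_inter] at a2
  rw [hℓ] at a2
  rw [hcard]
  have hℓ0 : 0 ≤ ℓ := hℓ ▸ Finset.sum_nonneg fun i _ => (hv i).le
  linarith

namespace WeightConditions
variable {ν : Measure ℝ} [IsProbabilityMeasure ν] {w : (n : ℕ) → Fin n → ℝ}
variable (hw : WeightConditions ν w)
include hw

lemma moment_one_pos : 0 < moment ν 1 :=
  integral_pow_pos hw.law_pos (integrable_id_of_cube hw.third_moment)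

lemma moment_three_pos : 0 < moment ν 3 := integral_pow_pos hw.law_pos hw.third_moment

lemma constC_pos : 0 < constC ν := div_pos hw.moment_three_pos hw.moment_one_pos

lemma eventually_totalWeight : ∀ᶠ n : ℕ in atTop, 1 ≤ n ∧
    |totalWeight (w n) - moment ν 1 * n| ≤ moment ν 1 / 10 * n := by
  have hm := hw.moment_one_pos
  filter_upwards [eventually_ge_atTop 1,
    eventually_abs_le hw.sum_one (by positivity : 0 < moment ν 1 / 10)] with n hn h
  have h1 : (1 : ℝ) ≤ n := by exact_mod_cast hn
  have h2 : (n : ℝ) ^ (2 / 3 : ℝ) ≤ n :=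
    Real.rpow_le_self_of_one_le h1 (by norm_num)
  exact ⟨hn, h.trans (mul_le_mul_of_nonneg_left h2 (by positivity))⟩

/-- The third moments of the weights are uniformly integrable. -/
lemma exists_tail_le {δ : ℝ} (hδ : 0 < δ) : ∃ K : ℝ, 0 < K ∧ ∀ᶠ n : ℕ in atTop,
    ∑ i with K < w n i, w n i ^ 3 ≤ δ * totalWeight (w n) := by
  have hm := hw.moment_one_pos
  set e := δ * moment ν 1 / 12 with he
  have he0 : 0 < e := by positivity
  obtain ⟨k, hk1, hk⟩ := ((eventually_ge_atTop 1).and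
    ((tendsto_integral_truncCube hw.law_pos hw.third_moment).eventually
      (lt_mem_nhds (show moment ν 3 - e < moment ν 3 by linarith)))).exists
  have hk0 : (0 : ℝ) < k := by exact_mod_cast hk1
  refine ⟨2 * k, by positivity, ?_⟩
  filter_upwards [hw.eventually_totalWeight, hw.sum_three.def he0,
    (hw.weak_limit (truncCube k)).eventually
      (lt_mem_nhds (show (∫ x, truncCube k x ∂ν) - e < ∫ x, truncCube k x ∂ν by linarith))]
    with n ⟨hn, h1⟩ h2 h3
  have hn0 : (0 : ℝ) < n := by exact_mod_cast hn
  rw [Real.norm_eq_abs, Real.norm_eq_abs, abs_of_pos hn0] at h2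
  rw [lt_div_iff₀ hn0] at h3
  -- For `w > 2k` the truncated cube `k³` is below `w³/2`, so `w³` is at most twice the truncation
  -- loss. The mean loss is small by weak convergence for the bounded truncation together with
  -- convergence of the third moments.
  have h4 : ∑ i with 2 * (k : ℝ) < w n i, w n i ^ 3
      ≤ ∑ i, 2 * (w n i ^ 3 - truncCube k (w n i)) := by
    have hnn : ∀ i, 0 ≤ 2 * (w n i ^ 3 - truncCube k (w n i)) := fun i => by
      rw [truncCube_apply]
      have := pow_le_pow_left₀ (le_max_left 0 (min (w n i) k))
        (max_le (hw.pos n i).le (min_le_left _ _)) 3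
      linarith
    refine le_trans (Finset.sum_le_sum fun i hi => ?_)
      (Finset.sum_le_sum_of_subset_of_nonneg (Finset.filter_subset _ _) fun i _ _ => hnn i)
    have hi := (Finset.mem_filter.1 hi).2
    rw [truncCube_apply, min_eq_right (by linarith), max_eq_right hk0.le]
    have := pow_le_pow_left₀ (by positivity) hi.le 3
    have := pow_pos hk0 3
    nlinarith
  rw [← Finset.mul_sum, Finset.sum_sub_distrib] at h4
  have h5 := (abs_le.1 h2).2
  have h6 := (abs_le.1 h1).1
  have h7 : (moment ν 3 - 2 * e) * n ≤ ∑ i, truncCube k (w n i) := by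
    have : (moment ν 3 - 2 * e) * n ≤ ((∫ x, truncCube k x ∂ν) - e) * n :=
      mul_le_mul_of_nonneg_right (by linarith) hn0.le
    linarith
  have h8 : 6 * e * n ≤ δ * totalWeight (w n) := by
    have h9 : moment ν 1 * n / 2 ≤ totalWeight (w n) := by
      have := mul_pos hm hn0
      linarith
    calc 6 * e * n = δ * (moment ν 1 * n / 2) := by rw [he]; ring
      _ ≤ _ := mul_le_mul_of_nonneg_left h9 hδ.le
  linarith

/-- For large `n` the weights satisfy the conditions needed for the exploration. -/
lemma eventually_valid {f : ℕ → ℝ} (hf : f =o[atTop] fun n : ℕ => (n : ℝ) ^ (1 / 3 : ℝ))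
    {F η δ K κ : ℝ} (hF : ∀ᶠ n in atTop, F ≤ f n) (hF1 : 1 ≤ F)
    (hF2 : 2 * (constC ν + 1) ≤ δ ^ 2 * F) (hF3 : 32 * (constC ν + 1) ≤ F)
    (hK : ∀ᶠ n : ℕ in atTop, ∑ i with K < w n i, w n i ^ 3 ≤ δ / 4 * totalWeight (w n))
    (hκ : ∀ (n : ℕ) (v : Fin n → ℝ) (lam g : ℝ), (Setup.mk v lam g (constC ν) (moment ν 1 / 4) 2
      (1 / 16) (2 / moment ν 1) η δ K κ).ConstValid) :
    ∀ᶠ n : ℕ in atTop, (Setup.mk (w n) (totalWeight (w n) ^ (1 / 3 : ℝ)) (f n) (constC ν)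
      (moment ν 1 / 4) 2 (1 / 16) (2 / moment ν 1) η δ K κ).Valid := by
  have hm := hw.moment_one_pos
  have hC := hw.constC_pos
  have hκ0 : 0 < κ := (hκ 0 (fun _ => 0) 0 0).κ_pos
  have hκ1 : κ ≤ 1 / 4 := (hκ 0 (fun _ => 0) 0 0).κ_le
  have hδ0 : 0 < δ := (hκ 0 (fun _ => 0) 0 0).δ_pos
  -- `D` converts powers of `n` into powers of `λ` through `n^(1/3) ≤ D λ`; `s` below is the common
  -- level at which the little-o conditions are applied.
  set D := (2 / moment ν 1) ^ (1 / 3 : ℝ) with hD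
  have hD0 : 0 < D := by positivity
  have hD3 : D ^ 3 = 2 / moment ν 1 := by
    rw [hD, ← Real.rpow_natCast, ← Real.rpow_mul (by positivity)]; norm_num
  obtain ⟨s, hs0, hsm, hs1, hs2, hs3⟩ : ∃ s : ℝ, 0 < s ∧ s ≤ moment ν 1 / 20 ∧ s * D ≤ κ ∧ 2 * s * D ^ 2 ≤ κ ∧
      s * (1 + constC ν) * (2 / moment ν 1) ≤ κ := by
    have : ∀ᶠ s in 𝓝[>] (0 : ℝ), 0 < s ∧ s ≤ moment ν 1 / 20 ∧ s * D ≤ κ ∧ 2 * s * D ^ 2 ≤ κ ∧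
        s * (1 + constC ν) * (2 / moment ν 1) ≤ κ := by
      filter_upwards [self_mem_nhdsWithin,
        eventually_le_of_continuous (g := fun s => s) (c := moment ν 1 / 20) (by fun_prop)
          (by positivity),
        eventually_le_of_continuous (g := fun s => s * D) (c := κ) (by fun_prop) (by simpa),
        eventually_le_of_continuous (g := fun s => 2 * s * D ^ 2) (c := κ) (by fun_prop)
          (by simpa),
        eventually_le_of_continuous (g := fun s => s * (1 + constC ν) * (2 / moment ν 1))
          (c := κ) (by fun_prop) (by simpa)] with s h1 h2 h3 h4 h5
      exact ⟨h1, h2, h3, h4, h5⟩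
    exact this.exists
  filter_upwards [hw.eventually_totalWeight, hF, hK, eventually_abs_le hf hs0,
    eventually_abs_le hw.max_weight hs0, eventually_abs_le hw.sum_one hs0,
    eventually_abs_le hw.sum_two hs0, hw.sum_three.def hs0]
    with n ⟨hn, h1⟩ h2 h3 h4 h5 h6 h7 h8
  have hn0 : (0 : ℝ) < n := by exact_mod_cast hn
  have hn1 : (1 : ℝ) ≤ n := by exact_mod_cast hn
  set ℓ := totalWeight (w n) with hℓ
  have hmn := mul_pos hm hn0
  have hℓ1 : 9 / 10 * (moment ν 1 * n) ≤ ℓ := by linarith [(abs_le.1 h1).1]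
  have hℓ0 : 0 < ℓ := by linarith
  set lam := ℓ ^ (1 / 3 : ℝ) with hlam
  have hlam0 : 0 < lam := by positivity
  have hlam3 : lam ^ 3 = ℓ := by
    rw [hlam, ← Real.rpow_natCast, ← Real.rpow_mul hℓ0.le]; norm_num
  set N := (n : ℝ) ^ (1 / 3 : ℝ) with hN
  have hN0 : 0 < N := by positivity
  have hN3 : N ^ 3 = n := by
    rw [hN, ← Real.rpow_natCast, ← Real.rpow_mul hn0.le]; norm_num
  have hN2 : (n : ℝ) ^ (2 / 3 : ℝ) = N ^ 2 := by
    rw [hN, ← Real.rpow_natCast, ← Real.rpow_mul hn0.le]; norm_num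
  rw [hN2] at h6 h7
  have hN2n : N ^ 2 ≤ n := by
    rw [← hN2]; exact Real.rpow_le_self_of_one_le hn1 (by norm_num)
  have hnℓ : (n : ℝ) ≤ 2 / moment ν 1 * ℓ := by
    rw [div_mul_eq_mul_div, le_div_iff₀ hm]; linarith
  have hNlam : N ≤ D * lam := by
    refine (pow_le_pow_iff_left₀ hN0.le (by positivity) (n := 3) (by norm_num)).1 ?_
    rw [mul_pow, hN3, hD3, hlam3]; exact hnℓ
  have hN2lam : N ^ 2 ≤ D ^ 2 * lam ^ 2 := by
    rw [← mul_pow]; exact pow_le_pow_left₀ hN0.le hNlam 2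
  have hsmall : s * N ≤ κ * lam := by
    have := mul_le_mul_of_nonneg_left hNlam hs0.le
    have := mul_le_mul_of_nonneg_right hs1 hlam0.le
    linarith
  have hsum2 : |∑ i, w n i ^ 2 - lam ^ 3| ≤ κ * lam ^ 2 := by
    -- Criticality enters here: as the first two moments of the limit agree, the two centrings
    -- cancel and the difference is of order `o(n^(2/3))`.
    have e : ∑ i, w n i ^ 2 - lam ^ 3
        = (∑ i, w n i ^ 2 - moment ν 2 * n) - (ℓ - moment ν 1 * n) := by
      rw [hlam3, hw.second_eq_first]; ring
    rw [e]
    refine (abs_sub _ _).trans ?_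
    have := mul_le_mul_of_nonneg_left hN2lam hs0.le
    have := mul_le_mul_of_nonneg_right hs2 (sq_nonneg lam)
    linarith
  have hsum2' : ∑ i, w n i ^ 2 ≤ 7 / 6 * ℓ := by
    have a1 : s * N ^ 2 ≤ moment ν 1 / 20 * n := mul_le_mul hsm hN2n (sq_nonneg N) (by positivity)
    have a2 := (abs_le.1 h7).2
    rw [hw.second_eq_first] at a2
    linarith
  refine { toConstValid := hκ n _ _ _, w_pos := hw.pos n, lam_pos := hlam0, one_le_f := hF1.trans h2,
           f_sq := ?_, f_C := hF3.trans h2, f_le := ((le_abs_self _).trans h4).trans hsmall,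
           w_le := fun i => ?_, sum_one := ?_, sum_two := hsum2, sum_three := ?_, tail := ?_,
           mid_card := ?_, card_le := ?_ }
  · refine hF2.trans (mul_le_mul_of_nonneg_left ?_ (sq_nonneg δ))
    change F ≤ f n ^ 2
    nlinarith
  · refine le_trans (le_ciSup (f := w n) (Set.finite_range _).bddAbove i) ?_
    exact ((le_abs_self _).trans h5).trans hsmall
  · exact hlam3.symm
  · change |∑ i, w n i ^ 3 - constC ν * lam ^ 3| ≤ κ * lam ^ 3
    have e : ∑ i, w n i ^ 3 - constC ν * lam ^ 3
        = (∑ i, w n i ^ 3 - moment ν 3 * n) - constC ν * (ℓ - moment ν 1 * n) := by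
      have : constC ν * moment ν 1 = moment ν 3 := div_mul_cancel₀ _ hm.ne'
      rw [hlam3, ← this]; ring
    rw [Real.norm_eq_abs, Real.norm_eq_abs, abs_of_pos hn0] at h8
    rw [e, hlam3]
    refine (abs_sub _ _).trans ?_
    rw [abs_mul, abs_of_pos hC]
    have a1 := mul_le_mul_of_nonneg_left h6 hC.le
    have a2 := mul_le_mul_of_nonneg_left hN2n (mul_pos hC hs0).le
    have a3 := mul_le_mul_of_nonneg_left hnℓ (by positivity : 0 ≤ s * (1 + constC ν))
    have a4 := mul_le_mul_of_nonneg_right hs3 hℓ0.le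
    linarith
  · change _ ≤ δ / 4 * lam ^ 3
    rw [hlam3]; exact h3
  · change 1 / 16 * lam ^ 3 ≤ _
    rw [hlam3]
    exact card_typical hm (hw.pos n) rfl hℓ1 hsum2'
  · change (n : ℝ) ≤ 2 / moment ν 1 * lam ^ 3
    rw [hlam3]; exact hnℓ

end WeightConditions
end RankOne

end

/-! ### The theorem, with its constants in order -/

theorem mainTheorem1 (ν : MeasureTheory.Measure ℝ) [MeasureTheory.IsProbabilityMeasure ν] :
    ∃ A : ℝ, 0 < A ∧ ∀ ε : ℝ, 0 < ε → ε ≤ 1 →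
      ∃ F : ℝ, 0 < F ∧
        ∀ w : (n : ℕ) → Fin n → ℝ, RankOne.WeightConditions ν w →
        ∀ f : ℕ → ℝ, (f =o[Filter.atTop] fun n : ℕ => (n : ℝ) ^ (1 / 3 : ℝ)) →
          (∀ᶠ n in Filter.atTop, F ≤ f n) →
          ∀ᶠ n in Filter.atTop,
            (RankOne.edgeLaw (w n) (RankOne.critParam (RankOne.totalWeight (w n)) (f n))).real
              {ω | ¬ RankOne.GiantEvent (RankOne.constC ν) ε (f n) (w n) (RankOne.graphOf ω)}
              ≤ A * Real.exp (-(f n) / A) := by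
  -- The 7 counts six deviations and one cluster bound; in the exponent, `exp (-f) ≤ exp (-f/7)`.
  refine ⟨7, by norm_num, fun ε hε hε1 => ?_⟩
  -- Positivity of `C` and of the first moment comes from the weight conditions. If no weight
  -- vectors satisfy them, any `F` works; otherwise one instance supplies these facts about `ν`.
  by_cases hex : ∃ w : (n : ℕ) → Fin n → ℝ, RankOne.WeightConditions ν w
  swap
  · exact ⟨1, one_pos, fun w hw => absurd ⟨w, hw⟩ hex⟩
  obtain ⟨w₀, hw₀⟩ := hex
  have hC := hw₀.constC_pos
  have hm := hw₀.moment_one_pos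
  obtain ⟨δ, hδ0, hδ1, hδ2, hδ3, hδ4⟩ :=
    RankOne.exists_small_error hC (by positivity : 0 < ε / 100)
  set C := RankOne.constC ν
  have hF1 : 0 ≤ 2 * (C + 1) / δ ^ 2 := by positivity
  -- `F` must be fixed before the weights, so it involves only `C` and `δ`; its three summands serve
  -- `one_le_f`, `f_C` and `f_sq`. `K` and `κ`, chosen afterwards, only affect how large `n` must
  -- be.
  refine ⟨1 + 32 * (C + 1) + 2 * (C + 1) / δ ^ 2, by positivity, fun w hw f hf hF => ?_⟩
  obtain ⟨K, hK0, hK⟩ := hw.exists_tail_le (by positivity : 0 < δ / 4)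
  obtain ⟨κ, hκ⟩ := RankOne.exists_constValid (c₁ := RankOne.moment ν 1 / 4) (c₂ := 2)
    (c₃ := 1 / 16) (c₄ := 2 / RankOne.moment ν 1) hC (by positivity) two_pos (by norm_num)
    (by positivity : 0 < ε / 100) (by linarith) hδ0 hδ1 hδ2 hδ3 hδ4 hK0
  have hval := hw.eventually_valid hf hF (by linarith) (by
    have : δ ^ 2 * (2 * (C + 1) / δ ^ 2) = 2 * (C + 1) := by field_simp
    have : 0 ≤ δ ^ 2 * (1 + 32 * (C + 1)) := by positivity
    linarith) (by linarith) hK hκ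
  filter_upwards [hval, hF] with n hn hfn
  refine (RankOne.Setup.edgeLaw_not_giantEvent_le hn (ε := ε) rfl).trans ?_
  refine mul_le_mul_of_nonneg_left (Real.exp_le_exp.2 ?_) (by norm_num)
  have : 0 ≤ f n := le_trans (by positivity) hfn
  change -f n ≤ _
  linarith
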